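/- Let $T=\mathrm{conv}(x_1,x_2,x_3,x_4)\subset\mathbb R^3$ be a non-degenerate tetrahedron with barycentric coordinates $\lambda_1,\dots,\lambda_4$, and let $n\ge 0$ be an integer. For a multi-index $\alpha\in\mathbb Z_{\ge0}^4$ with $|\alpha|=m$ let $B^m_\alpha=\frac{m!}{\alpha_1!\alpha_2!\alpha_3!\alpha_4!}\lambda_1^{\alpha_1}\lambda_2^{\alpha_2}\lambda_3^{\alpha_3}\lambda_4^{\alpha_4}$ be the Bernstein polynomial, let $e_\ell$ be the $\ell$-th unit multi-index, and let $\mathring{\mathcal I}^{m}=\{\alpha\in\mathbb Z_{\ge0}^4: |\alpha|=m,\ \alpha_i>0 \text{ for all } i\}$. For $\ell\in\{1,2,3,4\}$ and $\alpha\in\mathring{\mathcal I}^{n+2}$ put $$\Psi^{n+1}_{\ell,\alpha}=(n+2)\,B^{n+1}_{\alpha-e_\ell}\nabla\lambda_\ell-\frac{\alpha_\ell}{n+2}\,\nabla B^{n+2}_\alpha .$$ Let $\mathbb P_n$ be the polynomials of degree at most $n$ and $\widetilde{\mathbb P}_n$ the homogeneous polynomials of degree $n$ in three variables, and let $\mathrm{ND}^1_n=\mathbb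 P_n^3\oplus x\times\widetilde{\mathbb P}_n^3$. Let $H_0(\mathrm{curl};T)$ be the space of $v\in L^2(T)^3$ with distributional curl in $L^2(T)^3$ and vanishing tangential trace on every face of $T$, and let $H_0(\mathrm{div}^0;T)$ be the space of $v\in L^2(T)^3$ with distributional divergence zero and vanishing normal trace on every face of $T$ (traces being understood in the weak sense, through Green's formula). Then: 1. $\Psi^{n+1}_{\ell,\alpha}\in H_0(\mathrm{curl};T)\cap \mathrm{ND}^1_n$ for all $\ell\in\{1,2,3,4\}$ and $\alpha\in\mathring{\mathcal I}^{n+2}$. 2. The set $$\bigcup_{\ell=1}^{2}\{\Psi^{n+1}_{\ell,\alpha}:\alpha\in\mathring{\mathcal I}^{n+2}\}\ \cup\ \{\Psi^{n+1}_{3,\alpha}:\alpha\in\mathring{\mathcal I}^{n+2},\ \alpha_3=1\}$$ consists of $2\binom{n+1}{3}+\binom n2$ vector fields, and the family of these fields, labelled by the pairs $(\ell,\alpha)$, is linearly independent. 3. The family of the curls of these fields, labelled by the same pairs $(\ell,\alpha)$, is a basis of $H_0(\mathrm{div}^0;T)\cap\mathbb P_n^3$. -/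

import Mathlib

open MeasureTheory Set
open scoped ContDiff RealInnerProductSpace

/-- Physical space `ℝ³` with its Euclidean structure. -/
abbrev E3 : Type := EuclideanSpace ℝ (Fin 3)

namespace BernsteinCurl

/-! ### Vector calculus -/

/-- The partial derivative `∂ᵢ vⱼ` of a vector field at `x`. -/
noncomputable def partialDeriv (v : E3 → E3) (i j : Fin 3) (x : E3) : ℝ :=
  fderiv ℝ v x (EuclideanSpace.single i 1) j

/-- The curl of a (differentiable) vector field. -/
noncomputable def curl (v : E3 → E3) (x : E3) : E3 :=
  !₂[partialDeriv v 1 2 x - partialDeriv v 2 1 x,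
     partialDeriv v 2 0 x - partialDeriv v 0 2 x,
     partialDeriv v 0 1 x - partialDeriv v 1 0 x]

/-- The cross product on `ℝ³`. -/
noncomputable def cross (x y : E3) : E3 :=
  WithLp.toLp 2 (crossProduct (WithLp.ofLp x) (WithLp.ofLp y))

/-! ### Polynomial vector fields -/

/-- The vector field on `ℝ³` whose components are the polynomials `p 0, p 1, p 2`. -/
noncomputable def polyField (p : Fin 3 → MvPolynomial (Fin 3) ℝ) (x : E3) : E3 :=
  WithLp.toLp 2 fun i => MvPolynomial.eval (WithLp.ofLp x) (p i)

/-- `ℙₙ³`: vector fields whose components are polynomials of total degree at most `n`. -/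
def polyVec (n : ℕ) : Set (E3 → E3) :=
  {v | ∃ p : Fin 3 → MvPolynomial (Fin 3) ℝ, (∀ i, (p i).totalDegree ≤ n) ∧ v = polyField p}

/-- Vector fields whose components are homogeneous polynomials of degree `n` (or zero). -/
def homogPolyVec (n : ℕ) : Set (E3 → E3) :=
  {v | ∃ p : Fin 3 → MvPolynomial (Fin 3) ℝ, (∀ i, (p i).IsHomogeneous n) ∧ v = polyField p}

/-- The Nédélec space of the first kind, `ℙₙ³ ⊕ x × ℙ̃ₙ³`. (The sum is direct, since nonzero
elements of the second summand are homogeneous of degree `n + 1`.) -/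
def nedelec (n : ℕ) : Set (E3 → E3) :=
  {v | ∃ u ∈ polyVec n, ∃ q ∈ homogPolyVec n, v = fun x => u x + cross x (q x)}

/-! ### The tetrahedron and its function spaces

A non-degenerate tetrahedron is given by its four affinely independent vertices `T 0, …, T 3`,
that is, by an affine basis `T` of `ℝ³`. -/

/-- The closed tetrahedron with vertices `T 0, …, T 3`. -/
def tet (T : AffineBasis (Fin 4) ℝ E3) : Set E3 := convexHull ℝ (range T)

/-- Lebesgue measure on the tetrahedron. -/
noncomputable def tetVol (T : AffineBasis (Fin 4) ℝ E3) : Measure E3 :=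
  volume.restrict (tet T)

/-- `w` is the distributional curl of `v` in the interior of the tetrahedron. -/
def HasWeakCurl (T : AffineBasis (Fin 4) ℝ E3) (v w : E3 → E3) : Prop :=
  ∀ φ : E3 → E3, ContDiff ℝ ∞ φ → HasCompactSupport φ → tsupport φ ⊆ interior (tet T) →
    ∫ x, ⟪v x, curl φ x⟫ ∂(tetVol T) = ∫ x, ⟪w x, φ x⟫ ∂(tetVol T)

/-- `g` is the distributional divergence of `v` in the interior of the tetrahedron. -/
def HasWeakDiv (T : AffineBasis (Fin 4) ℝ E3) (v : E3 → E3) (g : E3 → ℝ) : Prop :=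
  ∀ φ : E3 → ℝ, ContDiff ℝ ∞ φ → HasCompactSupport φ → tsupport φ ⊆ interior (tet T) →
    ∫ x, ⟪v x, gradient φ x⟫ ∂(tetVol T) = -∫ x, g x * φ x ∂(tetVol T)

/-- `H(curl; T)`: fields in `L²(T)³` with distributional curl in `L²(T)³`. -/
def Hcurl (T : AffineBasis (Fin 4) ℝ E3) : Set (E3 → E3) :=
  {v | MemLp v 2 (tetVol T) ∧ ∃ w, MemLp w 2 (tetVol T) ∧ HasWeakCurl T v w}

/-- `H(div; T)`: fields in `L²(T)³` with distributional divergence in `L²(T)`. -/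
def Hdiv (T : AffineBasis (Fin 4) ℝ E3) : Set (E3 → E3) :=
  {v | MemLp v 2 (tetVol T) ∧ ∃ g, MemLp g 2 (tetVol T) ∧ HasWeakDiv T v g}

/-- The tangential trace of `v ∈ H(curl; T)` vanishes on all faces of `T`. The tangential trace
is the boundary functional of Green's formula,
`φ ↦ ∫_T curl v · φ - ∫_T v · curl φ` (which is `∫_∂T (ν × v) · φ` for smooth `v`, with
outward unit normal `ν`), tested with all fields `φ` that are smooth up to the boundary. -/
def TangentialTraceZero (T : AffineBasis (Fin 4) ℝ E3) (v : E3 → E3) : Prop :=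
  ∃ w, MemLp w 2 (tetVol T) ∧ HasWeakCurl T v w ∧
    ∀ φ : E3 → E3, ContDiff ℝ ∞ φ →
      ∫ x, ⟪w x, φ x⟫ ∂(tetVol T) - ∫ x, ⟪v x, curl φ x⟫ ∂(tetVol T) = 0

/-- The normal trace of `v ∈ H(div; T)` vanishes on all faces of `T`. The normal trace is the
boundary functional of Green's formula, `φ ↦ ∫_T v · ∇φ + ∫_T (div v) φ` (which is
`∫_∂T (v · ν) φ` for smooth `v`), tested with all `φ` that are smooth up to the boundary. -/
def NormalTraceZero (T : AffineBasis (Fin 4) ℝ E3) (v : E3 → E3) : Prop :=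
  ∃ g, MemLp g 2 (tetVol T) ∧ HasWeakDiv T v g ∧
    ∀ φ : E3 → ℝ, ContDiff ℝ ∞ φ →
      ∫ x, ⟪v x, gradient φ x⟫ ∂(tetVol T) + ∫ x, g x * φ x ∂(tetVol T) = 0

/-- `H₀(curl; T)`. -/
def H0curl (T : AffineBasis (Fin 4) ℝ E3) : Set (E3 → E3) :=
  {v | v ∈ Hcurl T ∧ TangentialTraceZero T v}

/-- `H₀(div; T)`. -/
def H0div (T : AffineBasis (Fin 4) ℝ E3) : Set (E3 → E3) :=
  {v | v ∈ Hdiv T ∧ NormalTraceZero T v}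

/-- `H₀(div⁰; T)`: the divergence-free fields in `H₀(div; T)`. -/
def H0divFree (T : AffineBasis (Fin 4) ℝ E3) : Set (E3 → E3) :=
  {v | v ∈ H0div T ∧ HasWeakDiv T v 0}

/-! ### Bernstein polynomials and cell bubbles -/

/-- The interior multi-indices of order `n`: all four entries are positive, with sum `n`. -/
def interiorIndex (n : ℕ) : Set (Fin 4 → ℕ) :=
  {α | ∑ i, α i = n ∧ ∀ i, 0 < α i}

/-- The Bernstein polynomial `B^{|α|}_α = (|α|! / α!) λ^α`, where `λᵢ = T.coord i` are the
barycentric coordinates. Its degree is determined by the multi-index. -/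
noncomputable def bernstein (T : AffineBasis (Fin 4) ℝ E3) (α : Fin 4 → ℕ) (x : E3) : ℝ :=
  (Nat.multinomial Finset.univ α : ℝ) * ∏ i, T.coord i x ^ α i

/-- The cell bubble
`Ψ^m_{ℓ,α} = (m+1) B^m_{α - e_ℓ} ∇λ_ℓ - (α_ℓ / (m+1)) ∇B^{m+1}_α`,
for `α` an interior multi-index of order `m + 1` (so `α - e_ℓ` is a multi-index of order `m`). -/
noncomputable def cellBubble (T : AffineBasis (Fin 4) ℝ E3) (m : ℕ) (ℓ : Fin 4)
    (α : Fin 4 → ℕ) (x : E3) : E3 :=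
  (((m : ℝ) + 1) * bernstein T (α - Pi.single ℓ 1) x) • gradient (T.coord ℓ) x
    - ((α ℓ : ℝ) / ((m : ℝ) + 1)) • gradient (bernstein T α) x

/-- Labels `(ℓ, α)` of the selected bubbles, `α` interior of order `n + 2`: the first two values
of `ℓ` with every `α`, and the third value of `ℓ` with those `α` whose third entry is `1`.
(Indices run over `0, 1, 2, 3`.) -/
def selected (n : ℕ) : Set (Fin 4 × (Fin 4 → ℕ)) :=
  {p | p.2 ∈ interiorIndex (n + 2) ∧ (p.1 = 0 ∨ p.1 = 1 ∨ (p.1 = 2 ∧ p.2 2 = 1))}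

/-- The selected family of cell bubbles. -/
noncomputable def selectedBubble (T : AffineBasis (Fin 4) ℝ E3) (n : ℕ) (p : selected n) :
    E3 → E3 :=
  cellBubble T (n + 1) p.1.1 p.1.2

end BernsteinCurl

/-! Everything is computed in the affine coordinates `X 0`, `X 1`, `X 2`, which stand for λ₀, λ₁,
λ₂, with λ₃ = 1 - λ₀ - λ₁ - λ₂. A field ∑ Pᵢ ∇λᵢ (`covField`) has curl ∑ aᵢ wᵢ (`contraField`),
where a = `curlPoly P` and the wᵢ = `faceVec` are the cross products of the ∇λⱼ. In these components
a divergence-free polynomial field without normal trace is a triple `a` with ∑ ∂ᵢaᵢ = 0, λᵢ ∣ aᵢ and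
λ₃ ∣ a₀ + a₁ + a₂ (`admissible`). The gradient part of a bubble has no curl, so up to a nonzero
factor its curl is that of λ^(α - e_ℓ) ∇λ_ℓ. The core is that the curls of the selected fields of
this form are a basis of the admissible triples.

Spanning (`exists_curl_potential`): integration of `a` along `X 2` from the face λ₂ = 0 gives the
potential (∫a₁, -∫a₀, 0), which need not vanish on λ₃ = 0. A gradient ∇F repairs this if F has the
right trace on that face and ∂₂F vanishes there. The selection α₂ = 1 for ℓ = 2 demands moreover
that ∂₂F be a polynomial in λ₀, λ₁, λ₃ alone. The choice F = Γ(λ₀, λ₁, 1 - λ₀ - λ₁) - Γ(λ₀, λ₁, λ₃)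
with homogeneous Γ meets all these demands.

Independence (`eq_zero_of_curlPoly_eq_zero`): if a combination of the selected fields is curl-free,
its third component has the form ∂₂F with such an F, the whole field is ∇F, and the vanishing on λ₃
= 0 forces Γ = 0. Independence of the bubbles themselves follows from that of their curls.

The analytic side consists of two facts. A divergence theorem (`integral_tet_diverg_eq_zero`),
proved with cutoff functions, shows that the algebraic vanishing conditions imply the weak boundary
conditions. Conversely, test functions of the form d ∏ λᵢ and F exp(-kλᵢ) recover ∑ ∂ᵢaᵢ = 0 and the
divisibility conditions from the weak ones. Membership in the Nédélec space rests on the Whitney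
forms λⱼ∇λ_ℓ - λ_ℓ∇λⱼ, each a constant plus x × constant. -/

namespace MvPolynomial

/-! ### Polynomial calculus: antiderivatives, degrees, divisibility, homogenisation -/

variable {τ ι : Type*}

theorem pderiv_bind₁_eq_sum [Fintype τ] (i : ι) (f : τ → MvPolynomial ι ℝ) (p : MvPolynomial τ ℝ) :
    pderiv i (bind₁ f p) = ∑ j, bind₁ f (pderiv j p) * pderiv i (f j) := by
  classical
  induction p using MvPolynomial.induction_on with
  | C a => simp
  | add p q hp hq => simp [hp, hq, add_mul, Finset.sum_add_distrib]
  | mul_X p k hp =>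
    simp only [map_mul, Derivation.leibniz, hp, bind₁_X_right, smul_eq_mul, map_add, add_mul,
      Finset.sum_add_distrib, pderiv_X]
    congr 1
    · rw [Finset.sum_eq_single k]
      · simp
      · intro b _ hb
        simp [Pi.single_eq_of_ne hb.symm]
      · simp
    · rw [Finset.mul_sum]
      exact Finset.sum_congr rfl fun j _ => by ring

/-- The commutator of two derivations is a derivation, so it is enough that it kills the variables.
-/
theorem pderiv_comm (i j : τ) (p : MvPolynomial τ ℝ) :
    pderiv i (pderiv j p) = pderiv j (pderiv i p) := by
  classical
  let D : τ → Derivation ℝ (MvPolynomial τ ℝ) (MvPolynomial τ ℝ) := pderiv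
  have h : ⁅D i, D j⁆ = 0 := by
    refine derivation_ext fun k => ?_
    rw [Derivation.commutator_apply]
    simp only [D, pderiv_X, Pi.single_apply, Derivation.coe_zero, Pi.zero_apply]
    split_ifs <;> simp
  have := congrArg (fun D => D p) h
  rw [Derivation.commutator_apply] at this
  exact sub_eq_zero.1 this

/-- The antiderivative with respect to `X i` without terms free of `X i`. -/
noncomputable def antideriv (i : τ) : MvPolynomial τ ℝ →ₗ[ℝ] MvPolynomial τ ℝ :=
  (basisMonomials τ ℝ).constr ℝ fun m => monomial (m + Finsupp.single i 1) ((m i + 1 : ℝ)⁻¹)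

theorem antideriv_monomial (i : τ) (m : τ →₀ ℕ) (c : ℝ) :
    antideriv i (monomial m c) = monomial (m + Finsupp.single i 1) (c * (m i + 1 : ℝ)⁻¹) := by
  have h : monomial m c = c • basisMonomials τ ℝ m := by
    rw [coe_basisMonomials, smul_monomial, smul_eq_mul, mul_one]
  rw [h, map_smul, antideriv, Module.Basis.constr_basis, smul_monomial, smul_eq_mul]

theorem pderiv_antideriv (i : τ) (p : MvPolynomial τ ℝ) : pderiv i (antideriv i p) = p := by
  induction p using MvPolynomial.induction_on' with
  | add p q hp hq => simp [hp, hq]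
  | monomial m c =>
    rw [antideriv_monomial, pderiv_monomial]
    have : (m i + 1 : ℝ) ≠ 0 := by positivity
    congr 1
    · simp
    · simp [this]

theorem pderiv_antideriv_of_ne {i j : τ} (h : j ≠ i) (p : MvPolynomial τ ℝ) :
    pderiv j (antideriv i p) = antideriv i (pderiv j p) := by
  classical
  induction p using MvPolynomial.induction_on' with
  | add p q hp hq => simp [hp, hq]
  | monomial m c =>
    rw [antideriv_monomial, pderiv_monomial, pderiv_monomial, antideriv_monomial]
    by_cases hm : m j = 0
    · simp [hm, Finsupp.single_eq_of_ne h]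
    congr 1
    · congr 1
      ext k
      by_cases hk : k = j
      · subst hk; simp [Finsupp.single_eq_of_ne h]
      · simp [Finsupp.single_eq_of_ne hk]
    · simp [Finsupp.single_eq_of_ne h, Finsupp.single_eq_of_ne h.symm]
      ring

/-- Divisibility by `X i` excludes the terms free of `X i`, the only ones that differentiation
loses. -/
theorem antideriv_pderiv {i : τ} {p : MvPolynomial τ ℝ} (hp : X i ∣ p) :
    antideriv i (pderiv i p) = p := by
  obtain ⟨q, rfl⟩ := hp
  induction q using MvPolynomial.induction_on' with
  | add p q hp hq => simp only [mul_add, map_add, hp, hq]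
  | monomial m c =>
    rw [X, monomial_mul, pderiv_monomial, antideriv_monomial]
    have : (m i + 1 : ℝ) ≠ 0 := by positivity
    congr 1
    · ext k; simp [add_comm]
    · simp [add_comm]
      field_simp

theorem X_dvd_antideriv (i : τ) (p : MvPolynomial τ ℝ) : X i ∣ antideriv i p := by
  induction p using MvPolynomial.induction_on' with
  | add p q hp hq => rw [map_add]; exact dvd_add hp hq
  | monomial m c =>
    rw [antideriv_monomial, ← mul_one (c * _), ← monomial_mul]
    exact Dvd.intro_left _ rfl

theorem antideriv_X_mul {i j : τ} (h : j ≠ i) (p : MvPolynomial τ ℝ) :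
    antideriv i (X j * p) = X j * antideriv i p := by
  induction p using MvPolynomial.induction_on' with
  | add p q hp hq => simp only [mul_add, map_add, hp, hq]
  | monomial m c =>
    rw [X, monomial_mul, antideriv_monomial, antideriv_monomial, monomial_mul, add_assoc]
    simp [Finsupp.single_eq_of_ne h.symm]

/-- Reduces degree bounds for linear maps to monomials; used below with `e` the successor, the
truncated predecessor and the identity. -/
theorem totalDegree_le_of_forall_monomial {d : ℕ} {e : ℕ → ℕ} (he : Monotone e)
    (D : MvPolynomial τ ℝ →ₗ[ℝ] MvPolynomial ι ℝ) {p : MvPolynomial τ ℝ} (hp : p.totalDegree ≤ d)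
    (hD : ∀ m c, (D (monomial m c)).totalDegree ≤ e m.degree) :
    (D p).totalDegree ≤ e d := by
  rw [p.as_sum, map_sum]
  refine totalDegree_finsetSum_le fun m hm => (hD m _).trans (he ?_)
  exact (le_totalDegree hm).trans hp

theorem totalDegree_antideriv_le (i : τ) {d : ℕ} {p : MvPolynomial τ ℝ} (hp : p.totalDegree ≤ d) :
    (antideriv i p).totalDegree ≤ d + 1 := by
  refine totalDegree_le_of_forall_monomial (e := (· + 1)) (fun a b h => by simpa using h) _ hp ?_
  intro m c
  rw [antideriv_monomial]
  refine (totalDegree_monomial_le _ _).trans ?_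
  change (m + Finsupp.single i 1).degree ≤ m.degree + 1
  simp

theorem totalDegree_pderiv_le (i : τ) {d : ℕ} {p : MvPolynomial τ ℝ}
    (hp : p.totalDegree ≤ d + 1) : (pderiv i p).totalDegree ≤ d := by
  classical
  refine totalDegree_le_of_forall_monomial (e := (· - 1))
    (fun a b h => Nat.sub_le_sub_right h 1) (pderiv i).toLinearMap hp ?_
  intro m c
  simp only [Derivation.coeFn_coe, pderiv_monomial]
  by_cases hm : m i = 0
  · simp [hm]
  refine (totalDegree_monomial_le _ _).trans ?_
  have h : m = (m - Finsupp.single i 1) + Finsupp.single i 1 := by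
    ext k
    by_cases hk : k = i
    · subst hk; simp; omega
    · simp [Finsupp.single_eq_of_ne hk]
  have h2 := congrArg Finsupp.degree h
  simp only [map_add, Finsupp.degree_single] at h2
  change (m - Finsupp.single i 1).degree ≤ _
  omega

theorem totalDegree_bind₁_le {f : τ → MvPolynomial ι ℝ} (hf : ∀ j, (f j).totalDegree ≤ 1) {d : ℕ}
    {p : MvPolynomial τ ℝ} (hp : p.totalDegree ≤ d) : (bind₁ f p).totalDegree ≤ d := by
  refine totalDegree_le_of_forall_monomial (e := id) monotone_id (bind₁ f).toLinearMap hp ?_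
  intro m c
  simp only [AlgHom.toLinearMap_apply, bind₁_monomial, id]
  refine (totalDegree_mul _ _).trans ?_
  rw [totalDegree_C, zero_add]
  refine (totalDegree_finsetProd _ _).trans ?_
  rw [Finsupp.degree_apply]
  refine Finset.sum_le_sum fun j _ => (totalDegree_pow _ _).trans ?_
  simpa using Nat.mul_le_mul_left (m j) (hf j)

/-- Modulo `d` every variable equals its image under `f`, hence so does every polynomial. This
yields the factor theorem for faces, with `f` a parametrisation of the plane `d = 0`. -/
theorem dvd_sub_bind₁ {d : MvPolynomial τ ℝ} {f : τ → MvPolynomial τ ℝ}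
    (hf : ∀ j, d ∣ X j - f j) (p : MvPolynomial τ ℝ) : d ∣ p - bind₁ f p := by
  induction p using MvPolynomial.induction_on with
  | C a => simp
  | add p q hp hq =>
    rw [map_add, add_sub_add_comm]
    exact dvd_add hp hq
  | mul_X p k hp =>
    rw [map_mul, bind₁_X_right]
    have : p * X k - bind₁ f p * f k = (p - bind₁ f p) * X k + bind₁ f p * (X k - f k) := by ring
    rw [this]
    exact dvd_add (hp.mul_right _) ((hf k).mul_left _)

theorem dvd_of_bind₁_eq_zero {d : MvPolynomial τ ℝ} {f : τ → MvPolynomial τ ℝ}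
    (hf : ∀ j, d ∣ X j - f j) {p : MvPolynomial τ ℝ} (hp : bind₁ f p = 0) : d ∣ p := by
  simpa [hp] using dvd_sub_bind₁ hf p

/-- A homogeneous polynomial vanishing on the hyperplane of coordinate sum one is zero. -/
theorem IsHomogeneous.eq_zero_of_forall_sum_eq_one [Fintype ι] [Nonempty ι] {m : ℕ}
    {p : MvPolynomial ι ℝ} (hp : p.IsHomogeneous m)
    (h : ∀ y : ι → ℝ, ∑ i, y i = 1 → eval y p = 0) : p = 0 := by
  have hX : (∑ i, X i : MvPolynomial ι ℝ) ≠ 0 := by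
    intro h0
    have := congrArg (eval fun _ => (1 : ℝ)) h0
    simp at this
  -- Rescaling to coordinate sum one handles all points with nonzero sum; the extra factor takes
  -- care of the others.
  have : p * ∑ i, X i = 0 := by
    refine MvPolynomial.funext fun y => ?_
    rw [map_mul, map_sum, map_zero]
    simp only [eval_X]
    by_cases hs : ∑ i, y i = 0
    · rw [hs, mul_zero]
    have h1 := h (fun i => (∑ i, y i)⁻¹ * y i) (by rw [← Finset.mul_sum, inv_mul_cancel₀ hs])
    have h3 : eval (fun i => (∑ i, y i)⁻¹ * y i) p = ((∑ i, y i)⁻¹) ^ m * eval y p := by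
      rw [eval_eq', eval_eq', Finset.mul_sum]
      refine Finset.sum_congr rfl fun d hd => ?_
      have hdm : ∑ i, d i = m := by
        rw [← Finsupp.degree_eq_sum]
        exact not_not.1 fun h => mem_support_iff.1 hd (hp.coeff_eq_zero h)
      simp only [mul_pow]
      rw [Finset.prod_mul_distrib, Finset.prod_pow_eq_pow_sum, hdm]
      ring
    rw [h3] at h1
    rcases mul_eq_zero.1 h1 with h4 | h4
    · exact absurd h4 (pow_ne_zero _ (inv_ne_zero hs))
    · rw [h4, zero_mul]
  exact (mul_eq_zero.1 this).resolve_right hX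

/-- Every polynomial of degree at most `d` arises from a homogeneous polynomial of degree `d`
by setting the sum of the variables to one. -/
theorem exists_isHomogeneous_bind₁ [Fintype ι] {d : ℕ} {p : MvPolynomial τ ℝ}
    (hp : p.totalDegree ≤ d) {f : τ → MvPolynomial ι ℝ} (hf : ∀ j, (f j).IsHomogeneous 1) :
    ∃ q : MvPolynomial ι ℝ, q.IsHomogeneous d ∧
      ∀ g : ι → MvPolynomial τ ℝ, ∑ i, g i = 1 → bind₁ g q = bind₁ g (bind₁ f p) := by
  -- Each monomial is padded to degree `d` by a power of the sum of the variables, which `g` sends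
  -- to one.
  refine ⟨∑ m ∈ p.support, bind₁ f (monomial m (coeff m p)) * (∑ i, X i) ^ (d - m.degree), ?_, ?_⟩
  · refine IsHomogeneous.sum _ _ _ fun m hm => ?_
    have hmd : m.degree ≤ d := (le_totalDegree hm).trans hp
    have h1 : (bind₁ f (monomial m (coeff m p))).IsHomogeneous m.degree := by
      rw [bind₁_monomial]
      have := (isHomogeneous_C ι (coeff m p)).mul
        (IsHomogeneous.prod m.support (fun j => f j ^ m j) (fun j => 1 * m j)
          fun j _ => (hf j).pow (m j))
      simpa [Finsupp.degree_apply, Finsupp.prod] using this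
    have h2 : ((∑ i, X i : MvPolynomial ι ℝ) ^ (d - m.degree)).IsHomogeneous
        (1 * (d - m.degree)) :=
      (IsHomogeneous.sum _ _ _ fun i _ => isHomogeneous_X ℝ i).pow _
    have := h1.mul h2
    rwa [one_mul, Nat.add_sub_cancel' hmd] at this
  · intro g hg
    conv_rhs => rw [p.as_sum, map_sum, map_sum]
    rw [map_sum]
    refine Finset.sum_congr rfl fun m _ => ?_
    rw [map_mul, map_pow, map_sum]
    simp [hg]

end MvPolynomial

/-! ### Barycentric coordinates as polynomials and restriction to faces -/

namespace BernsteinCurl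

open MvPolynomial

/-- Polynomials in three affine coordinates. -/
abbrev Poly3 : Type := MvPolynomial (Fin 3) ℝ

/-- The barycentric coordinates as polynomials in the first three of them. -/
noncomputable def bary : Fin 4 → Poly3 := ![X 0, X 1, X 2, 1 - X 0 - X 1 - X 2]

/-- The divergence of a triple of polynomials. -/
noncomputable def divPoly (a : Fin 3 → Poly3) : Poly3 :=
  pderiv 0 (a 0) + pderiv 1 (a 1) + pderiv 2 (a 2)

/-- The curl of a triple of polynomials. -/
noncomputable def curlPoly : (Fin 3 → Poly3) →ₗ[ℝ] (Fin 3 → Poly3) where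
  toFun P := ![pderiv 1 (P 2) - pderiv 2 (P 1), pderiv 2 (P 0) - pderiv 0 (P 2),
    pderiv 0 (P 1) - pderiv 1 (P 0)]
  map_add' P Q := by
    ext1 i; fin_cases i <;> simp <;> ring
  map_smul' c P := by
    ext1 i; fin_cases i <;> simp [smul_sub]

/-- Restriction to the face on which the last barycentric coordinate vanishes. -/
noncomputable def restrictLast : Poly3 →ₐ[ℝ] Poly3 := bind₁ ![X 0, X 1, 1 - X 0 - X 1]

/-- Exchange of the last two barycentric coordinates. -/
noncomputable def swapLast : Poly3 →ₐ[ℝ] Poly3 := bind₁ ![X 0, X 1, 1 - X 0 - X 1 - X 2]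

/-- Setting the `i`-th coordinate to zero. -/
noncomputable def restrictCoord (i : Fin 3) : Poly3 →ₐ[ℝ] Poly3 :=
  bind₁ fun j => if j = i then 0 else X j

@[simp] theorem restrictLast_X_zero : restrictLast (X 0) = X 0 := by simp [restrictLast]
@[simp] theorem restrictLast_X_one : restrictLast (X 1) = X 1 := by simp [restrictLast]
@[simp] theorem restrictLast_X_two : restrictLast (X 2) = 1 - X 0 - X 1 := by simp [restrictLast]
@[simp] theorem swapLast_X_zero : swapLast (X 0) = X 0 := by simp [swapLast]
@[simp] theorem swapLast_X_one : swapLast (X 1) = X 1 := by simp [swapLast]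
@[simp] theorem swapLast_X_two : swapLast (X 2) = 1 - X 0 - X 1 - X 2 := by simp [swapLast]
@[simp] theorem restrictCoord_X_self (i : Fin 3) : restrictCoord i (X i) = 0 := by
  simp [restrictCoord]
theorem restrictCoord_X_of_ne {i j : Fin 3} (h : j ≠ i) : restrictCoord i (X j) = X j := by
  simp [restrictCoord, h]

theorem algHom_comp_bind₁ (φ : Poly3 →ₐ[ℝ] Poly3) (f : Fin 3 → Poly3) (p : Poly3) :
    φ (bind₁ f p) = bind₁ (fun i => φ (f i)) p := by
  induction p using MvPolynomial.induction_on with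
  | C a => simp [← algebraMap_eq]
  | add p q hp hq => simp [hp, hq]
  | mul_X p k hp => simp [hp]

theorem restrictLast_restrictLast (p : Poly3) :
    restrictLast (restrictLast p) = restrictLast p := by
  conv_lhs => rw [restrictLast.eq_def, algHom_comp_bind₁, ← restrictLast.eq_def]
  conv_rhs => rw [restrictLast]
  congr 2; funext i; fin_cases i <;> simp

theorem restrictCoord_swapLast (p : Poly3) : restrictCoord 2 (swapLast p) = restrictLast p := by
  rw [swapLast, algHom_comp_bind₁, restrictLast]
  congr 2; funext i; fin_cases i <;> simp [restrictCoord_X_of_ne]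

theorem restrictCoord_restrictLast (p : Poly3) :
    restrictCoord 2 (restrictLast p) = restrictLast p := by
  rw [restrictLast, algHom_comp_bind₁]
  congr 2; funext i; fin_cases i <;> simp [restrictCoord_X_of_ne]

theorem restrictLast_restrictCoord (p : Poly3) :
    restrictLast (restrictCoord 2 p) = restrictCoord 2 p := by
  rw [restrictCoord, algHom_comp_bind₁]
  congr 2; funext i; fin_cases i <;> simp

theorem pderiv_zero_restrictLast (p : Poly3) :
    pderiv 0 (restrictLast p) = restrictLast (pderiv 0 p) - restrictLast (pderiv 2 p) := by
  rw [restrictLast, pderiv_bind₁_eq_sum, Fin.sum_univ_three]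
  simp [pderiv_X]; ring

theorem pderiv_one_restrictLast (p : Poly3) :
    pderiv 1 (restrictLast p) = restrictLast (pderiv 1 p) - restrictLast (pderiv 2 p) := by
  rw [restrictLast, pderiv_bind₁_eq_sum, Fin.sum_univ_three]
  simp [pderiv_X]; ring

theorem pderiv_two_restrictLast (p : Poly3) : pderiv 2 (restrictLast p) = 0 := by
  rw [restrictLast, pderiv_bind₁_eq_sum, Fin.sum_univ_three]
  simp [pderiv_X]

theorem pderiv_two_swapLast (p : Poly3) : pderiv 2 (swapLast p) = -swapLast (pderiv 2 p) := by
  rw [swapLast, pderiv_bind₁_eq_sum, Fin.sum_univ_three]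
  simp [pderiv_X]

theorem bary_three_dvd_of_restrictLast {p : Poly3} (hp : restrictLast p = 0) : bary 3 ∣ p := by
  refine dvd_of_bind₁_eq_zero (fun j => ?_) hp
  fin_cases j
  · simp
  · simp
  · exact ⟨-1, by simp [bary]⟩

theorem restrictLast_bary_three : restrictLast (bary 3) = 0 := by simp [bary]

theorem restrictLast_eq_zero_of_dvd {p : Poly3} (hp : bary 3 ∣ p) : restrictLast p = 0 := by
  obtain ⟨q, rfl⟩ := hp
  rw [map_mul, restrictLast_bary_three, zero_mul]

theorem X_dvd_of_restrictCoord {i : Fin 3} {p : Poly3} (hp : restrictCoord i p = 0) : X i ∣ p := by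
  refine dvd_of_bind₁_eq_zero (fun j => ?_) hp
  by_cases h : j = i
  · simp [h]
  · simp [h]

theorem restrictCoord_eq_zero_of_dvd {i : Fin 3} {p : Poly3} (hp : X i ∣ p) :
    restrictCoord i p = 0 := by
  obtain ⟨q, rfl⟩ := hp
  rw [map_mul, restrictCoord_X_self, zero_mul]

/-- If `φ` kills only multiples of `e` and does not kill `d`, then `φ p = 0` must come from the
cofactor of `d`, since the target is a domain. This replaces coprimality arguments for products of
face coordinates. -/
theorem mul_dvd_of_algHom {d e p : Poly3} (φ : Poly3 →ₐ[ℝ] Poly3)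
    (hφ : ∀ q, φ q = 0 → e ∣ q) (hd : φ d ≠ 0) (hdp : d ∣ p) (hp : φ p = 0) : d * e ∣ p := by
  obtain ⟨q, rfl⟩ := hdp
  rw [map_mul] at hp
  exact mul_dvd_mul_left d (hφ q ((mul_eq_zero.1 hp).resolve_left hd))

theorem mul_X_dvd {d p : Poly3} {i : Fin 3} (hd : restrictCoord i d ≠ 0) (hdp : d ∣ p)
    (hp : X i ∣ p) : d * X i ∣ p :=
  mul_dvd_of_algHom (restrictCoord i) (fun _ => X_dvd_of_restrictCoord) hd hdp
    (restrictCoord_eq_zero_of_dvd hp)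

theorem mul_bary_three_dvd {d p : Poly3} (hd : restrictLast d ≠ 0) (hdp : d ∣ p)
    (hp : restrictLast p = 0) : d * bary 3 ∣ p :=
  mul_dvd_of_algHom restrictLast (fun _ => bary_three_dvd_of_restrictLast) hd hdp hp

theorem one_sub_X_sub_X_ne_zero : (1 - X 0 - X 1 : Poly3) ≠ 0 := by
  intro h
  simpa using congrArg (eval 0) h

theorem one_sub_X_ne_zero (i : Fin 3) : (1 - X i : Poly3) ≠ 0 := by
  intro h
  simpa using congrArg (eval 0) h

theorem bary_three_ne_zero : bary 3 ≠ 0 := by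
  intro h
  simpa [bary] using congrArg (eval 0) h

theorem X_dvd_pderiv {i j : Fin 3} (h : i ≠ j) {p : Poly3} (hp : X i ∣ p) :
    X i ∣ pderiv j p := by
  obtain ⟨q, rfl⟩ := hp
  rw [pderiv_mul, pderiv_X_of_ne h, zero_mul, zero_add]
  exact dvd_mul_right _ _

/-- A polynomial with vanishing third partial derivative does not involve the third variable. -/
theorem restrictLast_eq_self {p : Poly3} (hp : pderiv 2 p = 0) : restrictLast p = p := by
  -- The difference from the value at `X 2 = 0` is divisible by `X 2` and has zero derivative, so it
  -- is the antiderivative of zero.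
  have h1 : X 2 ∣ p - restrictCoord 2 p := by
    refine X_dvd_of_restrictCoord ?_
    rw [map_sub, sub_eq_zero]
    have : restrictCoord 2 (restrictCoord 2 p) = restrictCoord 2 p := by
      conv_lhs => rw [restrictCoord.eq_def, algHom_comp_bind₁, ← restrictCoord.eq_def]
      conv_rhs => rw [restrictCoord]
      congr 2; funext i; fin_cases i <;> simp [restrictCoord_X_of_ne]
    rw [this]
  have h2 : pderiv 2 (p - restrictCoord 2 p) = 0 := by
    rw [map_sub, hp, ← restrictLast_restrictCoord, pderiv_two_restrictLast, sub_zero]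
  have h3 := antideriv_pderiv h1
  rw [h2, map_zero] at h3
  rw [sub_eq_zero.1 h3.symm, restrictLast_restrictCoord]

end BernsteinCurl

/-! ### The vector potential of an admissible triple and its uniqueness -/

namespace BernsteinCurl

open MvPolynomial

theorem eval_bind₁_eq {τ ι : Type*} (f : τ → MvPolynomial ι ℝ) (p : MvPolynomial τ ℝ) (y : ι → ℝ) :
    eval y (bind₁ f p) = eval (fun i => eval y (f i)) p := by
  induction p using MvPolynomial.induction_on with
  | C a => simp
  | add p q hp hq => simp [hp, hq]
  | mul_X p k hp => simp [hp]

/-- The potential (∫a₁, -∫a₀, 0) is made to vanish on λ₃ = 0 by a gradient whose potential restricts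
there to a function G with ∂₀G = -B, ∂₁G = A, where A and B are the values of ∫a₀ and ∫a₁ on the
face. The form of G supplies all the vanishing on edges that is needed later. The disjunction makes
`H` zero when `n < 2`. -/
theorem exists_face_potential {n : ℕ} {a : Fin 3 → Poly3} (ha : ∀ i, (a i).totalDegree ≤ n)
    (hdiv : divPoly a = 0) (hX : ∀ i, X i ∣ a i) (hw : bary 3 ∣ a 0 + a 1 + a 2) :
    ∃ H : Poly3, (H = 0 ∨ H.totalDegree + 2 ≤ n) ∧ restrictLast H = H ∧
      pderiv 0 (X 0 * X 1 * (1 - X 0 - X 1) ^ 2 * H) = -restrictLast (antideriv 2 (a 1)) ∧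
      pderiv 1 (X 0 * X 1 * (1 - X 0 - X 1) ^ 2 * H) = restrictLast (antideriv 2 (a 0)) := by
  set s : Poly3 := 1 - X 0 - X 1 with hs
  set A := restrictLast (antideriv 2 (a 0)) with hA
  set B := restrictLast (antideriv 2 (a 1)) with hB
  -- Closedness on the face: differentiation of the restrictions gives ∫(∂₀a₀ + ∂₁a₁) - (a₀ + a₁),
  -- which is -(a₀ + a₁ + a₂) by the divergence condition, and this is zero where λ₃ = 0.
  have hAB : pderiv 1 B = -pderiv 0 A := by
    have h2 : antideriv 2 (pderiv 2 (a 2)) = a 2 := antideriv_pderiv (hX 2)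
    have h3 : pderiv 0 (a 0) + pderiv 1 (a 1) = -pderiv 2 (a 2) :=
      eq_neg_of_add_eq_zero_left hdiv
    have h4 := restrictLast_eq_zero_of_dvd hw
    rw [hA, hB, pderiv_zero_restrictLast, pderiv_one_restrictLast,
      pderiv_antideriv_of_ne (i := 2) (j := 1) (by decide),
      pderiv_antideriv_of_ne (i := 2) (j := 0) (by decide), pderiv_antideriv, pderiv_antideriv]
    have h5 : restrictLast (antideriv 2 (pderiv 0 (a 0))) +
        restrictLast (antideriv 2 (pderiv 1 (a 1))) = -restrictLast (a 2) := by
      rw [← map_add, ← map_add, h3, map_neg, map_neg, h2]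
    simp only [map_add] at h4
    linear_combination h5 + (-1 : Poly3) * h4
  have hA0 : X 0 ∣ A := by
    obtain ⟨q, hq⟩ := hX 0
    rw [hA, hq, antideriv_X_mul (by decide), map_mul, restrictLast_X_zero]
    exact dvd_mul_right _ _
  have hB1 : X 1 ∣ B := by
    obtain ⟨q, hq⟩ := hX 1
    rw [hB, hq, antideriv_X_mul (by decide), map_mul, restrictLast_X_one]
    exact dvd_mul_right _ _
  -- The antiderivative starts at `X 2 = 0`, and `X 2` restricts to `s`.
  have hsr (p : Poly3) : s ∣ restrictLast (antideriv 2 p) := by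
    obtain ⟨q, hq⟩ := X_dvd_antideriv 2 p
    rw [hq, map_mul, restrictLast_X_two]
    exact dvd_mul_right _ _
  set G := antideriv 1 A with hG
  have hG1 : pderiv 1 G = A := pderiv_antideriv _ _
  have hG0 : pderiv 0 G = -B := by
    rw [hG, pderiv_antideriv_of_ne (by decide), ← neg_eq_iff_eq_neg.2 hAB, map_neg,
      antideriv_pderiv hB1]
  have hG2 : pderiv 2 G = 0 := by
    rw [hG, pderiv_antideriv_of_ne (by decide), hA, pderiv_two_restrictLast, map_zero]
  have hXG1 : X 1 ∣ G := X_dvd_antideriv _ _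
  have hXG0 : X 0 ∣ G := by
    obtain ⟨q, hq⟩ := hA0
    rw [hG, hq, antideriv_X_mul (by decide)]
    exact dvd_mul_right _ _
  -- On the edge s = 0 both A and B vanish, so G is constant there; as `X 0 ∣ G`, the constant is
  -- zero.
  have hsG : s ∣ G := by
    refine dvd_of_bind₁_eq_zero (f := ![X 0, 1 - X 0, X 2]) (fun j => ?_) ?_
    · fin_cases j
      · simp
      · exact ⟨-1, by simp [hs]⟩
      · simp
    set r : Poly3 →ₐ[ℝ] Poly3 := bind₁ ![X 0, 1 - X 0, X 2] with hr
    have hrs {p : Poly3} (hp : s ∣ p) : r p = 0 := by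
      obtain ⟨q, rfl⟩ := hp
      simp [hr, hs]
    have hd : pderiv 0 (r G) = 0 := by
      have h1 := hrs (hsr (a 0))
      have h2 := hrs (hsr (a 1))
      rw [hr, pderiv_bind₁_eq_sum, Fin.sum_univ_three, ← hr, hG0, hG1, hG2, map_neg, h1, h2]
      simp
    have hX0 : X 0 ∣ r G := by
      obtain ⟨q, hq⟩ := hXG0
      rw [hq, map_mul, hr, bind₁_X_right]
      exact dvd_mul_right _ _
    have h3 := antideriv_pderiv hX0
    rw [hd, map_zero] at h3
    exact h3.symm
  -- Not only G but also its derivative A vanishes on s = 0, so the zero is double.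
  have hs2G : s ^ 2 ∣ G := by
    obtain ⟨K, hK⟩ := hsG
    have h1 : s ∣ pderiv 1 G := by rw [hG1]; exact hsr _
    have h2 : s ∣ K := by
      have h3 : K = s * pderiv 1 K - pderiv 1 G := by
        rw [hK, pderiv_mul]
        have : pderiv 1 s = -1 := by simp [hs, pderiv_X]
        rw [this]; ring
      rw [h3]
      exact dvd_sub (dvd_mul_right _ _) h1
    rw [hK, sq]
    exact mul_dvd_mul_left s h2
  have hs0 : s ≠ 0 := one_sub_X_sub_X_ne_zero
  have h1 : s ^ 2 * X 0 ∣ G := by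
    refine mul_X_dvd ?_ hs2G hXG0
    have : restrictCoord 0 s = 1 - X 1 := by simp [hs, restrictCoord_X_of_ne]
    rw [map_pow, this]
    exact pow_ne_zero _ (one_sub_X_ne_zero 1)
  have h2 : s ^ 2 * X 0 * X 1 ∣ G := by
    refine mul_X_dvd ?_ h1 hXG1
    have : restrictCoord 1 s = 1 - X 0 := by simp [hs, restrictCoord_X_of_ne]
    rw [map_mul, map_pow, this, restrictCoord_X_of_ne (by decide)]
    exact mul_ne_zero (pow_ne_zero _ (one_sub_X_ne_zero 0)) (X_ne_zero 0)
  obtain ⟨H, hH⟩ := h2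
  have hGH : X 0 * X 1 * s ^ 2 * H = G := by rw [hH]; ring
  refine ⟨H, ?_, ?_, by rw [hGH, hG0], by rw [hGH, hG1]⟩
  · by_cases h0 : H = 0
    · exact Or.inl h0
    right
    -- Two integrations raise the degree by two; the factor of degree four then leaves `n - 2` for
    -- `H`.
    have hdeg : G.totalDegree ≤ n + 2 := by
      refine totalDegree_antideriv_le 1 (totalDegree_bind₁_le (fun j => ?_)
        (totalDegree_antideriv_le 2 (ha 0)))
      fin_cases j
      · simp
      · simp
      · simp only [Fin.reduceFinMk, Matrix.cons_val]
        refine (totalDegree_sub _ _).trans (max_le ((totalDegree_sub _ _).trans ?_) ?_) <;> simp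
    have hsdeg : 1 ≤ s.totalDegree := by
      have hmem : Finsupp.single (0 : Fin 3) 1 ∈ s.support := by
        rw [mem_support_iff, hs]
        simp [coeff_X, coeff_one, Finsupp.single_eq_single_iff, eq_comm (a := (0 : Fin 3 →₀ ℕ))]
      simpa using le_totalDegree hmem
    rw [← hGH, totalDegree_mul_of_isDomain, totalDegree_mul_of_isDomain,
      totalDegree_mul_of_isDomain, totalDegree_X, totalDegree_X, sq,
      totalDegree_mul_of_isDomain hs0 hs0] at hdeg
    · omega
    all_goals simp [hs0, h0]
  · have hc : s ^ 2 * X 0 * X 1 ≠ 0 := by simp [hs0]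
    apply mul_left_cancel₀ hc
    have h3 := restrictLast_eq_self hG2
    rw [hH] at h3
    conv_rhs => rw [← h3]
    simp [hs]

theorem totalDegree_bary_three_le : (bary 3).totalDegree ≤ 1 := by
  simp only [bary, Matrix.cons_val]
  refine (totalDegree_sub _ _).trans (max_le ((totalDegree_sub _ _).trans (max_le
    ((totalDegree_sub _ _).trans ?_) ?_)) ?_) <;> simp

theorem totalDegree_bary_three : (bary 3).totalDegree = 1 := by
  refine le_antisymm totalDegree_bary_three_le ?_
  have hmem : Finsupp.single (0 : Fin 3) 1 ∈ (bary 3).support := by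
    rw [mem_support_iff]
    simp [bary, coeff_X, coeff_one, Finsupp.single_eq_single_iff, eq_comm (a := (0 : Fin 3 →₀ ℕ))]
  simpa using le_totalDegree hmem

theorem totalDegree_swapLast_le {d : ℕ} {p : Poly3} (hp : p.totalDegree ≤ d) :
    (swapLast p).totalDegree ≤ d := by
  refine totalDegree_bind₁_le (fun j => ?_) hp
  fin_cases j
  · simp
  · simp
  · exact totalDegree_bary_three_le

theorem totalDegree_restrictLast_le {d : ℕ} {p : Poly3} (hp : p.totalDegree ≤ d) :
    (restrictLast p).totalDegree ≤ d := by
  refine totalDegree_bind₁_le (fun j => ?_) hp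
  fin_cases j
  · simp
  · simp
  · simp only [Fin.reduceFinMk, Matrix.cons_val]
    refine (totalDegree_sub _ _).trans (max_le ((totalDegree_sub _ _).trans ?_) ?_) <;> simp

theorem X_two_dvd_restrictLast_sub_swapLast (p : Poly3) : X 2 ∣ restrictLast p - swapLast p := by
  refine X_dvd_of_restrictCoord ?_
  rw [map_sub, restrictCoord_swapLast, restrictCoord_restrictLast, sub_self]

theorem restrictLast_swapLast_eq_zero {p : Poly3} (hp : X 2 ∣ p) :
    restrictLast (swapLast p) = 0 := by
  obtain ⟨q, rfl⟩ := hp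
  rw [map_mul, map_mul, swapLast_X_two]
  simp

/-- A polynomial of degree at most `n + 1` that vanishes on three faces is a multiple of the
product of their barycentric coordinates. -/
theorem exists_eq_X_mul_X_mul_bary {n : ℕ} {p : Poly3} {i j : Fin 3} (hij : i ≠ j)
    (hp : p.totalDegree ≤ n + 1) (hi : X i ∣ p) (hj : X j ∣ p) (hw : restrictLast p = 0) :
    ∃ H, p = X i * X j * bary 3 * H ∧ (H = 0 ∨ H.totalDegree + 2 ≤ n) := by
  have h1 : X i * X j ∣ p := by
    refine mul_X_dvd ?_ hi hj
    rw [restrictCoord_X_of_ne hij]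
    exact X_ne_zero i
  have hX (k : Fin 3) : restrictLast (X k) ≠ 0 := by
    fin_cases k
    · simp
    · simp
    · simpa using one_sub_X_sub_X_ne_zero
  have h2 : X i * X j * bary 3 ∣ p := by
    refine mul_bary_three_dvd ?_ h1 hw
    rw [map_mul]
    exact mul_ne_zero (hX i) (hX j)
  obtain ⟨H, hH⟩ := h2
  refine ⟨H, hH, ?_⟩
  by_cases h0 : H = 0
  · exact Or.inl h0
  right
  rw [hH, totalDegree_mul_of_isDomain, totalDegree_mul_of_isDomain, totalDegree_mul_of_isDomain,
    totalDegree_X, totalDegree_X, totalDegree_bary_three] at hp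
  · omega
  all_goals simp [h0, bary_three_ne_zero]

theorem IsHomogeneous_X_mul_pderiv {m : ℕ} {p : Poly3} (hp : p.IsHomogeneous m) (i : Fin 3) :
    (X i * pderiv i p).IsHomogeneous m := by
  rcases m with _ | m
  · have : pderiv i p = 0 := by
      rw [(totalDegree_eq_zero_iff_eq_C).1 (Nat.le_zero.1 hp.totalDegree_le), pderiv_C]
    rw [this, mul_zero]
    exact isHomogeneous_zero _ _ _
  · have := (isHomogeneous_X ℝ i).mul (hp.pderiv (i := i))
    rwa [Nat.add_sub_cancel, add_comm] at this

/-- The potential is (∫a₁ + ∂₀F, -∫a₀ + ∂₁F, ∂₂F), with F correcting the values on λ₃ = 0. Its third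
component is, apart from the face factors, a polynomial in λ₀, λ₁, λ₃ alone, written as `swapLast`
of a homogeneous `Q`; this is what the bubbles with α₂ = 1 can represent. -/
theorem exists_curl_potential {n : ℕ} {a : Fin 3 → Poly3} (ha : ∀ i, (a i).totalDegree ≤ n)
    (hdiv : divPoly a = 0) (hX : ∀ i, X i ∣ a i) (hw : bary 3 ∣ a 0 + a 1 + a 2) :
    ∃ H₀ H₁ Q : Poly3, (H₀ = 0 ∨ H₀.totalDegree + 2 ≤ n) ∧ (H₁ = 0 ∨ H₁.totalDegree + 2 ≤ n) ∧
      (Q = 0 ∨ ∃ m, m + 2 = n ∧ Q.IsHomogeneous m) ∧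
      curlPoly ![X 1 * X 2 * bary 3 * H₀, X 0 * X 2 * bary 3 * H₁,
        X 0 * X 1 * bary 3 * swapLast Q] = a := by
  obtain ⟨H, hdeg, hres, hd0, hd1⟩ := exists_face_potential ha hdiv hX hw
  -- On the face the three coordinates λ₀, λ₁, λ₂ sum to one, so `H` can be made homogeneous of
  -- degree `n - 2` in them.
  obtain ⟨K, hK, hKdeg⟩ : ∃ K : Poly3, restrictLast K = H ∧
      (K = 0 ∨ ∃ m, m + 2 = n ∧ K.IsHomogeneous m) := by
    rcases hdeg with rfl | hdeg
    · exact ⟨0, by simp, Or.inl rfl⟩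
    obtain ⟨m, rfl⟩ := Nat.exists_eq_add_of_le' ((Nat.le_add_left 2 _).trans hdeg)
    obtain ⟨K, hK, hKH⟩ := exists_isHomogeneous_bind₁ (p := H) (d := m) (by omega)
      (f := X) (fun j => isHomogeneous_X ℝ j)
    refine ⟨K, ?_, Or.inr ⟨m, rfl, hK⟩⟩
    have := hKH ![X 0, X 1, 1 - X 0 - X 1] (by rw [Fin.sum_univ_three]; simp)
    rw [bind₁_X_left, AlgHom.id_apply] at this
    exact this.trans hres
  -- The square leaves one factor `X 2` in ∂₂Γ, which the exchange turns into λ₃.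
  set Γ : Poly3 := X 0 * X 1 * X 2 ^ 2 * K with hΓ
  set G : Poly3 := X 0 * X 1 * (1 - X 0 - X 1) ^ 2 * H with hG
  have hΓG : restrictLast Γ = G := by simp [hΓ, hG, hK]
  -- The first term is free of `X 2`, and both agree at `X 2 = 0`. So F vanishes on λ₂ = 0 and ∂₂F
  -- is `swapLast (pderiv 2 Γ)`; on λ₃ = 0 the second term vanishes and F has the trace G.
  set F := restrictLast Γ - swapLast Γ with hF
  set Q := 2 * K + X 2 * pderiv 2 K with hQ
  have hdΓ : pderiv 2 Γ = X 0 * X 1 * X 2 * Q := by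
    simp [hΓ, hQ, pderiv_X]
    ring
  have hF2 : pderiv 2 F = X 0 * X 1 * bary 3 * swapLast Q := by
    rw [hF, map_sub, pderiv_two_restrictLast, pderiv_two_swapLast, hdΓ]
    simp [bary]
  have hX2F : X 2 ∣ F := X_two_dvd_restrictLast_sub_swapLast Γ
  have hX0F : X 0 ∣ F := by
    refine dvd_sub ?_ ?_
    · rw [hΓG, hG, mul_assoc, mul_assoc]; exact dvd_mul_right _ _
    · simp only [hΓ, map_mul, swapLast_X_zero, mul_assoc]; exact dvd_mul_right _ _
  have hX1F : X 1 ∣ F := by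
    refine dvd_sub ?_ ?_
    · rw [hΓG, hG, mul_comm (X 0), mul_assoc, mul_assoc]; exact dvd_mul_right _ _
    · simp only [hΓ, map_mul, swapLast_X_one, mul_assoc]; exact dvd_mul_of_dvd_right (dvd_mul_right _ _) _
  have hΓ2 : X 2 ∣ Γ := ⟨X 0 * X 1 * X 2 * K, by rw [hΓ]; ring⟩
  have hFG : restrictLast F = G := by
    rw [hF, map_sub, restrictLast_restrictLast, restrictLast_swapLast_eq_zero hΓ2, hΓG, sub_zero]
  have hdF2 : restrictLast (pderiv 2 F) = 0 := by
    rw [hF2, map_mul, map_mul, restrictLast_bary_three]; simp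
  have hdF0 : restrictLast (pderiv 0 F) = pderiv 0 G := by
    rw [← hFG, pderiv_zero_restrictLast, hdF2, sub_zero]
  have hdF1 : restrictLast (pderiv 1 F) = pderiv 1 G := by
    rw [← hFG, pderiv_one_restrictLast, hdF2, sub_zero]
  have hFdeg : F.totalDegree ≤ n + 2 := by
    rcases hKdeg with hK0 | ⟨m, hm, hKm⟩
    · simp [hF, hΓ, hK0]
    have hΓm : Γ.IsHomogeneous (1 + 1 + 1 * 2 + m) :=
      (((isHomogeneous_X ℝ 0).mul (isHomogeneous_X ℝ 1)).mul ((isHomogeneous_X ℝ 2).pow 2)).mul hKm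
    have hΓd : Γ.totalDegree ≤ n + 2 := hΓm.totalDegree_le.trans (by omega)
    exact (totalDegree_sub _ _).trans
      (max_le (totalDegree_restrictLast_le hΓd) (totalDegree_swapLast_le hΓd))
  have hIX {i : Fin 3} (hi : i ≠ 2) : X i ∣ antideriv 2 (a i) := by
    obtain ⟨q, hq⟩ := hX i
    rw [hq, antideriv_X_mul hi]
    exact dvd_mul_right _ _
  -- The trace of F on λ₃ = 0 was chosen to cancel that of the antiderivative.
  obtain ⟨H₀, hH₀, hH₀d⟩ := exists_eq_X_mul_X_mul_bary (n := n) (i := 1) (j := 2)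
    (p := pderiv 0 F + antideriv 2 (a 1)) (by decide)
    ((totalDegree_add _ _).trans (max_le (totalDegree_pderiv_le 0 hFdeg)
      (totalDegree_antideriv_le 2 (ha 1))))
    (dvd_add (X_dvd_pderiv (by decide) hX1F) (hIX (by decide)))
    (dvd_add (X_dvd_pderiv (by decide) hX2F) (X_dvd_antideriv _ _))
    (by rw [map_add, hdF0, hd0, neg_add_cancel])
  obtain ⟨H₁, hH₁, hH₁d⟩ := exists_eq_X_mul_X_mul_bary (n := n) (i := 0) (j := 2)
    (p := pderiv 1 F - antideriv 2 (a 0)) (by decide)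
    ((totalDegree_sub _ _).trans (max_le (totalDegree_pderiv_le 1 hFdeg)
      (totalDegree_antideriv_le 2 (ha 0))))
    (dvd_sub (X_dvd_pderiv (by decide) hX0F) (hIX (by decide)))
    (dvd_sub (X_dvd_pderiv (by decide) hX2F) (X_dvd_antideriv _ _))
    (by rw [map_sub, hdF1, hd1, sub_self])
  refine ⟨H₀, H₁, Q, hH₀d, hH₁d, ?_, ?_⟩
  · rcases hKdeg with hK0 | ⟨m, hm, hKm⟩
    · left; simp [hQ, hK0]
    · refine Or.inr ⟨m, hm, ?_⟩
      have h2 : (2 * K).IsHomogeneous m := by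
        rw [two_mul]; exact hKm.add hKm
      exact h2.add (IsHomogeneous_X_mul_pderiv hKm 2)
  · rw [← hH₀, ← hH₁, ← hF2]
    have h2 : antideriv 2 (pderiv 2 (a 2)) = a 2 := antideriv_pderiv (hX 2)
    have h3 : pderiv 0 (a 0) + pderiv 1 (a 1) = -pderiv 2 (a 2) :=
      eq_neg_of_add_eq_zero_left hdiv
    have h4 : -antideriv 2 (pderiv 0 (a 0)) - antideriv 2 (pderiv 1 (a 1)) = a 2 := by
      rw [← neg_add', ← map_add, h3, map_neg, neg_neg, h2]
    funext i
    fin_cases i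
    · simp only [curlPoly, LinearMap.coe_mk, AddHom.coe_mk, Matrix.cons_val, Fin.zero_eta, map_sub,
        pderiv_antideriv]
      rw [pderiv_comm 1 2 F]
      ring
    · simp only [curlPoly, LinearMap.coe_mk, AddHom.coe_mk, Matrix.cons_val, Fin.mk_one, map_add,
        pderiv_antideriv]
      rw [pderiv_comm 0 2 F]
      ring
    · simp only [curlPoly, LinearMap.coe_mk, AddHom.coe_mk, Matrix.cons_val, Fin.reduceFinMk,
        map_add, map_sub, ← h4]
      rw [pderiv_comm 0 1 F, pderiv_antideriv_of_ne (i := 2) (j := 1) (by decide),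
        pderiv_antideriv_of_ne (i := 2) (j := 0) (by decide)]
      ring

/-- With F as in the construction of the potential, the third component is ∂₂F. Curl-freeness and
the vanishing on λ₂ = 0 give `P₀` = ∂₀F and `P₁` = ∂₁F. On λ₃ = 0 both `P₀` and ∂₂F vanish, so the
trace of F there, which is that of Γ, does not depend on `X 0`; being divisible by `X 0` it is zero,
and homogeneity gives Γ = 0. -/
theorem eq_zero_of_curlPoly_eq_zero {d : ℕ} {P₀ P₁ Γ : Poly3} (hΓ : Γ.IsHomogeneous d)
    (hΓ0 : X 0 ∣ Γ) (hΓ2 : X 2 ∣ Γ) (hdΓ : X 2 ∣ pderiv 2 Γ) (h0 : X 2 ∣ P₀) (h1 : X 2 ∣ P₁)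
    (hw : bary 3 ∣ P₀) (hcurl : curlPoly ![P₀, P₁, swapLast (pderiv 2 Γ)] = 0) :
    P₀ = 0 ∧ P₁ = 0 ∧ Γ = 0 := by
  set F := restrictLast Γ - swapLast Γ with hF
  have hF2 : pderiv 2 F = swapLast (pderiv 2 Γ) := by
    rw [hF, map_sub, pderiv_two_restrictLast, pderiv_two_swapLast, zero_sub, neg_neg]
  have hX2F : X 2 ∣ F := X_two_dvd_restrictLast_sub_swapLast Γ
  have hP (i : Fin 3) (hi : 2 ≠ i) {P : Poly3} (hX : X 2 ∣ P)
      (hd : pderiv 2 P = pderiv i (pderiv 2 F)) : P = pderiv i F := by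
    rw [← antideriv_pderiv hX, hd, pderiv_comm, antideriv_pderiv (X_dvd_pderiv hi hX2F)]
  have hc0 := congrFun hcurl 0
  have hc1 := congrFun hcurl 1
  simp only [curlPoly, LinearMap.coe_mk, AddHom.coe_mk, Matrix.cons_val, Pi.zero_apply] at hc0 hc1
  have hP0 : P₀ = pderiv 0 F := hP 0 (by decide) h0 (by rw [hF2]; exact sub_eq_zero.1 hc1)
  have hP1 : P₁ = pderiv 1 F := hP 1 (by decide) h1 (by rw [hF2]; exact (sub_eq_zero.1 hc0).symm)
  have hG : restrictLast F = restrictLast Γ := by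
    rw [hF, map_sub, restrictLast_restrictLast, restrictLast_swapLast_eq_zero hΓ2, sub_zero]
  have hdG : pderiv 0 (restrictLast Γ) = 0 := by
    rw [← hG, pderiv_zero_restrictLast, hF2, restrictLast_swapLast_eq_zero hdΓ, ← hP0,
      restrictLast_eq_zero_of_dvd hw, sub_zero]
  have hG0 : restrictLast Γ = 0 := by
    have : X 0 ∣ restrictLast Γ := by
      obtain ⟨q, hq⟩ := hΓ0
      rw [hq, map_mul, restrictLast_X_zero]
      exact dvd_mul_right _ _
    rw [← antideriv_pderiv this, hdG, map_zero]
  have hΓz : Γ = 0 := by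
    refine hΓ.eq_zero_of_forall_sum_eq_one fun y hy => ?_
    have h := congrArg (eval y) hG0
    rw [Fin.sum_univ_three] at hy
    rw [restrictLast, eval_bind₁_eq, map_zero] at h
    convert h using 3
    funext i
    fin_cases i <;> simp
    linarith
  have hFz : F = 0 := by rw [hF, hΓz, map_zero, map_zero, sub_zero]
  exact ⟨by rw [hP0, hFz, map_zero], by rw [hP1, hFz, map_zero], hΓz⟩

end BernsteinCurl

/-! ### Bubbles in polynomial components: span and independence of the curls -/

namespace BernsteinCurl

open MvPolynomial

/-- Monomials in the barycentric coordinates. -/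
noncomputable def baryMonomial (β : Fin 4 → ℕ) : Poly3 := ∏ i, bary i ^ β i

/-- The Bernstein polynomials in the coordinates. -/
noncomputable def bernPoly (α : Fin 4 → ℕ) : Poly3 :=
  C (Nat.multinomial Finset.univ α : ℝ) * baryMonomial α

/-- The covariant components `λ^(α - e_ℓ) ∇λ_ℓ`. -/
noncomputable def monoBubble (ℓ : Fin 4) (α : Fin 4 → ℕ) (i : Fin 3) : Poly3 :=
  baryMonomial (α - Pi.single ℓ 1) * pderiv i (bary ℓ)

/-- The covariant components of the cell bubbles. -/
noncomputable def bubblePoly (m : ℕ) (ℓ : Fin 4) (α : Fin 4 → ℕ) (i : Fin 3) : Poly3 :=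
  C ((m : ℝ) + 1) * bernPoly (α - Pi.single ℓ 1) * pderiv i (bary ℓ) -
    C ((α ℓ : ℝ) / ((m : ℝ) + 1)) * pderiv i (bernPoly α)

theorem baryMonomial_add (β γ : Fin 4 → ℕ) :
    baryMonomial (β + γ) = baryMonomial β * baryMonomial γ := by
  simp [baryMonomial, pow_add, Finset.prod_mul_distrib]

theorem baryMonomial_single (ℓ : Fin 4) : baryMonomial (Pi.single ℓ 1) = bary ℓ := by
  rw [baryMonomial, Finset.prod_eq_single ℓ]
  · simp
  · intro b _ hb; simp [Pi.single_eq_of_ne hb]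
  · simp

theorem sub_single_add_single {α : Fin 4 → ℕ} {ℓ : Fin 4} (h : 0 < α ℓ) :
    α - Pi.single ℓ 1 + Pi.single ℓ 1 = α := by
  funext i
  by_cases hi : i = ℓ
  · subst hi; simp; omega
  · simp [Pi.single_eq_of_ne hi]

theorem bary_mul_baryMonomial_sub {α : Fin 4 → ℕ} {ℓ : Fin 4} (h : 0 < α ℓ) :
    baryMonomial (α - Pi.single ℓ 1) * bary ℓ = baryMonomial α := by
  conv_rhs => rw [← sub_single_add_single h, baryMonomial_add, baryMonomial_single]

theorem bary_dvd_baryMonomial {β : Fin 4 → ℕ} {j : Fin 4} (h : 0 < β j) :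
    bary j ∣ baryMonomial β :=
  (dvd_pow_self _ h.ne').trans (Finset.dvd_prod_of_mem _ (Finset.mem_univ j))

theorem bary_dvd_baryMonomial_sub {α : Fin 4 → ℕ} {ℓ j : Fin 4} (hj : j ≠ ℓ) (h : 0 < α j) :
    bary j ∣ baryMonomial (α - Pi.single ℓ 1) :=
  bary_dvd_baryMonomial (by simpa [Pi.single_eq_of_ne hj] using h)

theorem curlPoly_pderiv (p : Poly3) : curlPoly (fun i => pderiv i p) = 0 := by
  funext i
  fin_cases i
  · simp [curlPoly, pderiv_comm 1 2 p]
  · simp [curlPoly, pderiv_comm 2 0 p]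
  · simp [curlPoly, pderiv_comm 0 1 p]

/-- The gradient part contributes nothing; the remaining scalar is positive, so bubbles may be
traded for monomial fields in span and independence. -/
theorem curlPoly_bubblePoly (m : ℕ) (ℓ : Fin 4) (α : Fin 4 → ℕ) :
    curlPoly (bubblePoly m ℓ α) =
      (((m : ℝ) + 1) * (Nat.multinomial Finset.univ (α - Pi.single ℓ 1) : ℝ)) •
        curlPoly (monoBubble ℓ α) := by
  have : bubblePoly m ℓ α =
      (((m : ℝ) + 1) * (Nat.multinomial Finset.univ (α - Pi.single ℓ 1) : ℝ)) • monoBubble ℓ α -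
        ((α ℓ : ℝ) / ((m : ℝ) + 1)) • fun i => pderiv i (bernPoly α) := by
    funext i
    simp only [bubblePoly, bernPoly, monoBubble, Pi.sub_apply, Pi.smul_apply, smul_eq_C_mul, C_mul]
    ring
  rw [this, map_sub, map_smul, map_smul, curlPoly_pderiv, smul_zero, sub_zero]

theorem multinomial_pos (f : Fin 4 → ℕ) : 0 < Nat.multinomial Finset.univ f :=
  Nat.multinomial_pos _ _

theorem monoBubble_zero (α : Fin 4 → ℕ) :
    monoBubble 0 α = Pi.single 0 (baryMonomial (α - Pi.single 0 1)) := by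
  funext i; fin_cases i <;> simp [monoBubble, bary, pderiv_X]

theorem monoBubble_one (α : Fin 4 → ℕ) :
    monoBubble 1 α = Pi.single 1 (baryMonomial (α - Pi.single 1 1)) := by
  funext i; fin_cases i <;> simp [monoBubble, bary, pderiv_X]

theorem monoBubble_two (α : Fin 4 → ℕ) :
    monoBubble 2 α = Pi.single 2 (baryMonomial (α - Pi.single 2 1)) := by
  funext i; fin_cases i <;> simp [monoBubble, bary, pderiv_X]

theorem sum_bary : ∑ i, bary i = 1 := by
  simp [Fin.sum_univ_four, bary]

theorem bind₁_bary_monomial (β : Fin 4 →₀ ℕ) (c : ℝ) :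
    bind₁ bary (monomial β c) = c • baryMonomial β := by
  rw [bind₁_monomial, smul_eq_C_mul, baryMonomial, ← Finsupp.prod, Finsupp.prod_fintype]
  simp

/-- Polynomials of degree at most `m` are spanned by the barycentric monomials of degree `m`. -/
theorem mem_span_baryMonomial {m : ℕ} {p : Poly3} (hp : p.totalDegree ≤ m) :
    p ∈ Submodule.span ℝ {q | ∃ β : Fin 4 → ℕ, ∑ i, β i = m ∧ q = baryMonomial β} := by
  obtain ⟨q, hq, h⟩ := exists_isHomogeneous_bind₁ hp (ι := Fin 4)
    (f := fun j => X j.castSucc) (fun j => isHomogeneous_X ℝ _)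
  have h1 : p = bind₁ bary q := by
    rw [h bary sum_bary, bind₁_bind₁]
    have : (fun j : Fin 3 => bind₁ bary (X j.castSucc)) = X := by
      funext j; fin_cases j <;> simp [bary]
    rw [this, bind₁_X_left, AlgHom.id_apply]
  rw [h1, q.as_sum, map_sum]
  refine Submodule.sum_mem _ fun β hβ => ?_
  rw [bind₁_bary_monomial]
  refine Submodule.smul_mem _ _ (Submodule.subset_span ⟨β, ?_, rfl⟩)
  rw [← Finsupp.degree_eq_sum]
  exact not_not.1 fun h => mem_support_iff.1 hβ (hq.coeff_eq_zero h)

theorem swapLast_monomial (β : Fin 3 →₀ ℕ) (c : ℝ) :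
    swapLast (monomial β c) = c • (X 0 ^ β 0 * X 1 ^ β 1 * bary 3 ^ β 2) := by
  rw [swapLast, bind₁_monomial, smul_eq_C_mul, ← Finsupp.prod, Finsupp.prod_fintype]
  · simp [Fin.prod_univ_three, bary]
  · simp

/-- The curls of the bubbles span the divergence-free fields without normal trace. -/
theorem mem_span_curlPoly_bubblePoly {n : ℕ} {a : Fin 3 → Poly3}
    (ha : ∀ i, (a i).totalDegree ≤ n)
    (hdiv : divPoly a = 0) (hX : ∀ i, X i ∣ a i) (hw : bary 3 ∣ a 0 + a 1 + a 2) :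
    a ∈ Submodule.span ℝ
      (range fun p : selected n => curlPoly (bubblePoly (n + 1) p.1.1 p.1.2)) := by
  set S := Submodule.span ℝ
    (range fun p : selected n => curlPoly (bubblePoly (n + 1) p.1.1 p.1.2)) with hS
  have hmono {ℓ : Fin 4} {α : Fin 4 → ℕ} (h : (ℓ, α) ∈ selected n) :
      curlPoly (monoBubble ℓ α) ∈ S := by
    have h1 : curlPoly (bubblePoly (n + 1) ℓ α) ∈ S := Submodule.subset_span ⟨⟨_, h⟩, rfl⟩
    rw [curlPoly_bubblePoly] at h1
    refine (Submodule.smul_mem_iff _ (mul_ne_zero (by positivity) ?_)).1 h1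
    exact_mod_cast (multinomial_pos _).ne'
  obtain ⟨H₀, H₁, Q, hH₀, hH₁, hQ, rfl⟩ := exists_curl_potential ha hdiv hX hw
  have hsplit (x y z : Poly3) : ![x, y, z] =
      Pi.single 0 x + Pi.single 1 y + (Pi.single 2 z : Fin 3 → Poly3) := by
    funext i; fin_cases i <;> simp
  rw [hsplit, map_add, map_add]
  have hint {m : ℕ} (hm : m + 2 = n) {β : Fin 4 → ℕ} (hβ : ∑ i, β i = m) :
      β + 1 ∈ interiorIndex (n + 2) := by
    refine ⟨?_, fun i => by simp⟩
    rw [Fin.sum_univ_four] at hβ ⊢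
    simp only [Pi.add_apply, Pi.one_apply]
    omega
  -- By linearity `H` may be replaced by a barycentric monomial of degree `n - 2`.
  have key (i : Fin 3) (d : Poly3) {H : Poly3} (hH : H = 0 ∨ H.totalDegree + 2 ≤ n)
      (hβ : ∀ (m : ℕ) (β : Fin 4 → ℕ), m + 2 = n → ∑ i, β i = m →
        curlPoly (Pi.single i (d * baryMonomial β)) ∈ S) :
      curlPoly (Pi.single i (d * H)) ∈ S := by
    rcases hH with rfl | hH
    · simp
    obtain ⟨m, rfl⟩ := Nat.exists_eq_add_of_le' ((Nat.le_add_left 2 _).trans hH)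
    have h1 := mem_span_baryMonomial (p := H) (m := m) (by omega)
    clear hH
    induction h1 using Submodule.span_induction with
    | mem x hx =>
      obtain ⟨β, hβm, rfl⟩ := hx
      exact hβ m β rfl hβm
    | zero => simp
    | add x y _ _ hx hy =>
      rw [mul_add, Pi.single_add, map_add]
      exact S.add_mem hx hy
    | smul c x _ hx =>
      rw [mul_smul_comm, Pi.single_smul, map_smul]
      exact S.smul_mem c hx
  refine S.add_mem (S.add_mem (key 0 _ hH₀ ?_) (key 1 _ hH₁ ?_)) ?_
  · intro m β hm hβ
    have h1 := hmono (ℓ := 0) (α := β + 1) ⟨hint hm hβ, Or.inl rfl⟩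
    rw [monoBubble_zero] at h1
    convert h1 using 3
    simp [baryMonomial, Fin.prod_univ_four, bary, pow_succ]
    ring
  · intro m β hm hβ
    have h1 := hmono (ℓ := 1) (α := β + 1) ⟨hint hm hβ, Or.inr (Or.inl rfl)⟩
    rw [monoBubble_one] at h1
    convert h1 using 3
    simp [baryMonomial, Fin.prod_univ_four, bary, pow_succ]
    ring
  · rcases hQ with rfl | ⟨m, hm, hQ⟩
    · simp
    rw [Q.as_sum, map_sum, Finset.mul_sum]
    have hsum (f : (Fin 3 →₀ ℕ) → Poly3) : (Pi.single 2 (∑ β ∈ Q.support, f β) : Fin 3 → Poly3) =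
        ∑ β ∈ Q.support, Pi.single 2 (f β) := by
      exact map_sum (LinearMap.single ℝ (fun _ : Fin 3 => Poly3) 2) f Q.support
    rw [hsum, map_sum]
    refine S.sum_mem fun β hβ => ?_
    have hβm : β.degree = m := not_not.1 fun h => mem_support_iff.1 hβ (hQ.coeff_eq_zero h)
    rw [Finsupp.degree_eq_sum, Fin.sum_univ_three] at hβm
    -- After the exchange the third exponent of `β` belongs to λ₃; no λ₂ occurs, which is the case
    -- α₂ = 1.
    have h1 := hmono (ℓ := 2) (α := ![β 0 + 1, β 1 + 1, 1, β 2 + 1])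
      ⟨⟨by simp [Fin.sum_univ_four]; omega, fun i => by fin_cases i <;> simp⟩,
        Or.inr (Or.inr ⟨rfl, rfl⟩)⟩
    rw [monoBubble_two] at h1
    rw [swapLast_monomial, mul_smul_comm, Pi.single_smul, map_smul]
    refine S.smul_mem _ ?_
    have h2 : X 0 * X 1 * bary 3 * (X 0 ^ β 0 * X 1 ^ β 1 * bary 3 ^ β 2) =
        baryMonomial (![β 0 + 1, β 1 + 1, 1, β 2 + 1] - Pi.single 2 1) := by
      simp [baryMonomial, Fin.prod_univ_four, pow_succ]
      simp [bary]
      ring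
    rw [h2]
    exact h1

theorem eval_bary {y : Fin 4 → ℝ} (hy : ∑ i, y i = 1) (i : Fin 4) :
    eval (fun j : Fin 3 => y j.castSucc) (bary i) = y i := by
  rw [Fin.sum_univ_four] at hy
  fin_cases i <;> simp [bary]
  linarith

theorem coeff_sum_monomial {κ τ : Type*} {s : Finset κ} {e : κ → τ →₀ ℕ} {p : κ} (hp : p ∈ s)
    (he : ∀ q ∈ s, e q = e p → q = p) (c : κ → ℝ) :
    coeff (e p) (∑ q ∈ s, monomial (e q) (c q)) = c p := by
  classical
  rw [coeff_sum, Finset.sum_eq_single p]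
  · simp
  · intro q hq hqp
    rw [coeff_monomial, if_neg fun h => hqp (he q hq h)]
  · exact fun h => absurd hp h

/-- Barycentric monomials of a fixed degree are linearly independent. -/
theorem eq_zero_of_sum_baryMonomial {κ : Type*} {s : Finset κ} {α : κ → Fin 4 → ℕ} {m : ℕ}
    (hα : ∀ p ∈ s, ∑ i, α p i = m) (hinj : ∀ p ∈ s, ∀ q ∈ s, α p = α q → p = q) {c : κ → ℝ}
    (h : ∑ p ∈ s, c p • baryMonomial (α p) = 0) : ∀ p ∈ s, c p = 0 := by
  set e : κ → Fin 4 →₀ ℕ := fun p => Finsupp.equivFunOnFinite.symm (α p) with he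
  set R : MvPolynomial (Fin 4) ℝ := ∑ p ∈ s, monomial (e p) (c p) with hR
  have hRh : R.IsHomogeneous m := by
    refine IsHomogeneous.sum _ _ _ fun p hp => isHomogeneous_monomial _ ?_
    rw [Finsupp.degree_eq_sum, ← hα p hp]
    rfl
  have hRb : bind₁ bary R = 0 := by
    rw [hR, map_sum, ← h]
    exact Finset.sum_congr rfl fun p _ => bind₁_bary_monomial _ _
  have hR0 : R = 0 := by
    refine hRh.eq_zero_of_forall_sum_eq_one fun y hy => ?_
    have h1 := congrArg (eval fun j : Fin 3 => y j.castSucc) hRb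
    rw [eval_bind₁_eq, map_zero] at h1
    simpa only [eval_bary hy] using h1
  intro p hp
  rw [← coeff_sum_monomial (e := e) hp (fun q hq h =>
    hinj q hq p hp (Finsupp.equivFunOnFinite.symm.injective h)) c, ← hR, hR0, coeff_zero]

theorem monoBubble_apply_of_ne {ℓ : Fin 4} {α : Fin 4 → ℕ} {i : Fin 3} (hℓ : ℓ ≠ 3)
    (h : ℓ ≠ i.castSucc) : monoBubble ℓ α i = 0 := by
  fin_cases ℓ
  · fin_cases i <;> simp_all [monoBubble_zero]
  · fin_cases i <;> simp_all [monoBubble_one]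
  · fin_cases i <;> simp_all [monoBubble_two]
  · simp at hℓ

theorem monoBubble_castSucc (i : Fin 3) (α : Fin 4 → ℕ) :
    monoBubble i.castSucc α i = baryMonomial (α - Pi.single i.castSucc 1) := by
  fin_cases i
  · simp [monoBubble_zero]
  · simp [monoBubble_one]
  · simp [monoBubble_two]

theorem ne_three_of_mem_selected {n : ℕ} {p : Fin 4 × (Fin 4 → ℕ)} (hp : p ∈ selected n) :
    p.1 ≠ 3 := by
  rcases hp.2 with h | h | ⟨h, -⟩ <;> rw [h] <;> decide

/-- A vanishing combination of curls says that the combined field `P` is curl-free. The factors of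
the bubbles give `P` the divisibilities that `eq_zero_of_curlPoly_eq_zero` requires, so `P = 0`, and
each component is a combination of distinct barycentric monomials. -/
theorem linearIndependent_curlPoly_monoBubble (n : ℕ) :
    LinearIndependent ℝ fun p : selected n => curlPoly (monoBubble p.1.1 p.1.2) := by
  classical
  rw [linearIndependent_iff']
  intro s c hc
  set P : Fin 3 → Poly3 := ∑ p ∈ s, c p • monoBubble p.1.1 p.1.2 with hP
  have hPi (i : Fin 3) : P i = ∑ p ∈ s with p.1.1 = i.castSucc,
      c p • baryMonomial (p.1.2 - Pi.single i.castSucc 1) := by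
    rw [hP, Finset.sum_apply, Finset.sum_filter]
    refine Finset.sum_congr rfl fun p _ => ?_
    split_ifs with h
    · rw [Pi.smul_apply, h, monoBubble_castSucc]
    · rw [Pi.smul_apply, monoBubble_apply_of_ne (ne_three_of_mem_selected p.2) h, smul_zero]
  have hdvd (i : Fin 3) {j : Fin 4} (hij : j ≠ i.castSucc) : bary j ∣ P i := by
    rw [hPi]
    refine Finset.dvd_sum fun p _ => ?_
    rw [smul_eq_C_mul]
    exact (bary_dvd_baryMonomial_sub hij (p.2.1.2 j)).mul_left _
  -- The third slot carries the exponent of λ₃, raised by one because Γ is an antiderivative of `P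
  -- 2` before the exchange.
  set e : selected n → Fin 3 →₀ ℕ := fun p =>
    Finsupp.equivFunOnFinite.symm ![p.1.2 0, p.1.2 1, p.1.2 3 + 1] with he
  set t := s.filter fun p => p.1.1 = 2 with ht
  have ht2 {p : selected n} (hp : p ∈ t) : p.1.2 2 = 1 := by
    have h2 := (Finset.mem_filter.1 hp).2
    rcases p.2.2 with h | h | h
    · rw [h] at h2; exact absurd h2 (by decide)
    · rw [h] at h2; exact absurd h2 (by decide)
    · exact h.2
  set Γ : Poly3 := ∑ p ∈ t, monomial (e p) (c p * (p.1.2 3 + 1 : ℝ)⁻¹) with hΓ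
  have hΓh : Γ.IsHomogeneous (n + 2) := by
    refine IsHomogeneous.sum _ _ _ fun p hp => isHomogeneous_monomial _ ?_
    have h1 := p.2.1.1
    rw [Fin.sum_univ_four, ht2 hp] at h1
    rw [Finsupp.degree_eq_sum, Fin.sum_univ_three, ← h1]
    simp [he]
    ring
  have hXmono {i : Fin 3} {β : Fin 3 →₀ ℕ} (b : ℝ) (h : 0 < β i) :
      (X i : Poly3) ∣ monomial β b := by
    rw [X_dvd_monomial]
    exact Or.inr h.ne'
  have hdΓ : pderiv 2 Γ = ∑ p ∈ t, monomial
      (Finsupp.equivFunOnFinite.symm ![p.1.2 0, p.1.2 1, p.1.2 3]) (c p) := by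
    rw [hΓ, map_sum]
    refine Finset.sum_congr rfl fun p _ => ?_
    rw [pderiv_monomial]
    congr 1
    · congr 1
      ext i; fin_cases i <;> simp [he]
    · have : (p.1.2 3 + 1 : ℝ) ≠ 0 := by positivity
      simp [he, this]
  have hP2 : P 2 = swapLast (pderiv 2 Γ) := by
    rw [hPi, hdΓ, map_sum]
    refine Finset.sum_congr rfl fun p hp => ?_
    rw [swapLast_monomial]
    congr 1
    have h2 := ht2 hp
    simp [baryMonomial, Fin.prod_univ_four, h2]
    simp [bary]
  have hPvec : P = ![P 0, P 1, swapLast (pderiv 2 Γ)] := by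
    rw [← hP2]; funext i; fin_cases i <;> rfl
  have hcurl : curlPoly P = 0 := by
    rw [hP, map_sum, ← hc]
    exact Finset.sum_congr rfl fun p _ => map_smul _ _ _
  rw [hPvec] at hcurl
  obtain ⟨h0, h1, hΓ0⟩ := eq_zero_of_curlPoly_eq_zero hΓh
    (Finset.dvd_sum fun p _ => hXmono _ (by simpa [he] using p.2.1.2 0))
    (Finset.dvd_sum fun p _ => hXmono _ (by simp [he]))
    (hdΓ ▸ Finset.dvd_sum fun p _ => hXmono _ (by simpa using p.2.1.2 3))
    (hdvd 0 (j := 2) (by decide)) (hdvd 1 (j := 2) (by decide)) (hdvd 0 (j := 3) (by decide)) hcurl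
  have hcoeff (i : Fin 3) (h : P i = 0) : ∀ p ∈ s, p.1.1 = i.castSucc → c p = 0 := by
    intro p hp hpi
    refine eq_zero_of_sum_baryMonomial (κ := selected n) (s := s.filter fun p => p.1.1 = i.castSucc)
      (α := fun p => p.1.2) (m := n + 2) (fun p _ => p.2.1.1) ?_ ?_ p
      (Finset.mem_filter.2 ⟨hp, hpi⟩)
    · intro p hp q hq hpq
      exact Subtype.ext (Prod.ext ((Finset.mem_filter.1 hp).2.trans (Finset.mem_filter.1 hq).2.symm)
        hpq)
    -- The missing factor is restored to obtain full monomials λ^α, all of degree `n + 2`.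
    · have := congrArg (· * bary i.castSucc) (hPi i)
      simp only [h, zero_mul, Finset.sum_mul] at this
      rw [this]
      refine Finset.sum_congr rfl fun p _ => ?_
      rw [smul_mul_assoc, bary_mul_baryMonomial_sub (p.2.1.2 _)]
  have hP20 : P 2 = 0 := by rw [hP2, hΓ0, map_zero, map_zero]
  intro p hp
  rcases p.2.2 with h | h | h
  · exact hcoeff 0 h0 p hp h
  · exact hcoeff 1 h1 p hp h
  · exact hcoeff 2 hP20 p hp h.1

theorem linearIndependent_curlPoly_bubblePoly (n : ℕ) :
    LinearIndependent ℝ fun p : selected n => curlPoly (bubblePoly (n + 1) p.1.1 p.1.2) := by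
  have hu (p : selected n) : (((n + 1 : ℕ) : ℝ) + 1) *
      (Nat.multinomial Finset.univ (p.1.2 - Pi.single p.1.1 1) : ℝ) ≠ 0 :=
    mul_ne_zero (by positivity) (by exact_mod_cast (multinomial_pos _).ne')
  convert (linearIndependent_curlPoly_monoBubble n).units_smul fun p => Units.mk0 _ (hu p) using 1
  funext p
  rw [curlPoly_bubblePoly]
  rfl

end BernsteinCurl

/-! ### Counting the labels -/

namespace BernsteinCurl

/-- Stars and bars for positive multi-indices. -/
theorem encard_pos_sum_eq (k m : ℕ) :
    {α : Fin (k + 1) → ℕ | ∑ i, α i = m + 1 ∧ ∀ i, 0 < α i}.encard = (m.choose k : ℕ∞) := by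
  classical
  by_cases hkm : k ≤ m
  · obtain ⟨r, rfl⟩ := Nat.exists_eq_add_of_le hkm
    have h : {α : Fin (k + 1) → ℕ | ∑ i, α i = k + r + 1 ∧ ∀ i, 0 < α i} =
        (fun β : Fin (k + 1) →₀ ℕ => fun i => β i + 1) ''
          (Finset.finsuppAntidiag (Finset.univ : Finset (Fin (k + 1))) r : Set _) := by
      ext α
      simp only [Set.mem_ofPred_eq, Set.mem_image, Finset.mem_coe, Finset.mem_finsuppAntidiag]
      constructor
      · rintro ⟨hs, hp⟩
        refine ⟨Finsupp.equivFunOnFinite.symm fun i => α i - 1, ⟨?_, by simp⟩, ?_⟩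
        · have : ∑ i, α i = ∑ i, ((α i - 1) + 1) :=
            Finset.sum_congr rfl fun i _ => by have := hp i; omega
          rw [this, Finset.sum_add_distrib] at hs
          simp at hs ⊢
          omega
        · funext i; have := hp i; simp; omega
      · rintro ⟨β, ⟨hβ, -⟩, rfl⟩
        refine ⟨?_, fun i => Nat.succ_pos _⟩
        rw [Finset.sum_add_distrib, hβ]
        simp; omega
    rw [h, Function.Injective.encard_image, Set.encard_coe_eq_coe_finsetCard,
      Finset.card_finsuppAntidiag_nat_eq_choose, Finset.card_univ, Fintype.card_fin]
    · rw [Nat.add_right_comm, Nat.add_sub_cancel, add_comm k r]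
      norm_cast
      rw [add_comm]
      exact (Nat.choose_symm_add).symm
    · intro β γ hβγ
      ext i
      simpa using congrFun hβγ i
  · push Not at hkm
    rw [Nat.choose_eq_zero_of_lt hkm, Nat.cast_zero, Set.encard_eq_zero, Set.eq_empty_iff_forall_notMem]
    rintro α ⟨hs, hp⟩
    have : ∑ i : Fin (k + 1), 1 ≤ ∑ i, α i := Finset.sum_le_sum fun i _ => hp i
    simp at this
    omega

/-- With its third entry fixed at one, an index of the last block is a positive triple with sum `n +
1`. -/
theorem encard_selected (n : ℕ) :
    (selected n).encard = ((2 * (n + 1).choose 3 + n.choose 2 : ℕ) : ℕ∞) := by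
  have hI : (interiorIndex (n + 2)).encard = ((n + 1).choose 3 : ℕ∞) := encard_pos_sum_eq 3 (n + 1)
  have hJ := encard_pos_sum_eq 2 n
  set J := {α : Fin 3 → ℕ | ∑ i, α i = n + 1 ∧ ∀ i, 0 < α i}
  have h : selected n = Prod.mk 0 '' interiorIndex (n + 2) ∪
      (Prod.mk 1 '' interiorIndex (n + 2) ∪ (fun β => ((2 : Fin 4), ![β 0, β 1, 1, β 2])) '' J) := by
    ext ⟨ℓ, α⟩
    simp only [selected, Set.mem_ofPred_eq, Set.mem_union, Set.mem_image, Prod.mk.injEq]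
    constructor
    · rintro ⟨hα, rfl | rfl | ⟨rfl, h2⟩⟩
      · exact Or.inl ⟨α, hα, rfl, rfl⟩
      · exact Or.inr (Or.inl ⟨α, hα, rfl, rfl⟩)
      · refine Or.inr (Or.inr ⟨![α 0, α 1, α 3], ⟨?_, ?_⟩, rfl, ?_⟩)
        · have := hα.1
          rw [Fin.sum_univ_four] at this
          simp [Fin.sum_univ_three]
          omega
        · intro i; fin_cases i
          · exact hα.2 0
          · exact hα.2 1
          · exact hα.2 3
        · funext i; fin_cases i <;> simp [h2]
    · rintro (⟨β, hβ, rfl, rfl⟩ | ⟨β, hβ, rfl, rfl⟩ | ⟨β, hβ, rfl, rfl⟩)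
      · exact ⟨hβ, Or.inl rfl⟩
      · exact ⟨hβ, Or.inr (Or.inl rfl)⟩
      · refine ⟨⟨?_, ?_⟩, Or.inr (Or.inr ⟨rfl, rfl⟩)⟩
        · have := hβ.1
          rw [Fin.sum_univ_three] at this
          simp [Fin.sum_univ_four]
          omega
        · intro i; fin_cases i
          · exact hβ.2 0
          · exact hβ.2 1
          · exact Nat.one_pos
          · exact hβ.2 2
  have hinj : Function.Injective fun β : Fin 3 → ℕ => ((2 : Fin 4), ![β 0, β 1, 1, β 2]) := by
    intro β γ hβγ
    have h := (Prod.ext_iff.1 hβγ).2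
    funext i
    fin_cases i
    · simpa using congrFun h 0
    · simpa using congrFun h 1
    · simpa using congrFun h 3
  rw [h, Set.encard_union_eq, Set.encard_union_eq, (Prod.mk_right_injective _).encard_image,
    (Prod.mk_right_injective _).encard_image, hinj.encard_image, hI, hJ]
  · push_cast; ring
  · rw [Set.disjoint_left]
    rintro - ⟨β, -, rfl⟩ ⟨γ, -, hγ⟩
    simpa using congrArg Prod.fst hγ
  · rw [Set.disjoint_left]
    rintro - ⟨β, -, rfl⟩ (⟨γ, -, hγ⟩ | ⟨γ, -, hγ⟩)
    · simpa using congrArg Prod.fst hγ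
    · simpa using congrArg Prod.fst hγ

end BernsteinCurl

/-! ### From polynomial components to fields on space -/

namespace BernsteinCurl

open MvPolynomial

/-- The constant gradient of a barycentric coordinate. -/
noncomputable def grad (T : AffineBasis (Fin 4) ℝ E3) (i : Fin 4) : E3 :=
  (InnerProductSpace.toDual ℝ E3).symm (LinearMap.toContinuousLinearMap (T.coord i).linear)

/-- The first three barycentric coordinates of a point. -/
noncomputable def lam (T : AffineBasis (Fin 4) ℝ E3) (x : E3) (j : Fin 3) : ℝ :=
  T.coord j.castSucc x

variable (T : AffineBasis (Fin 4) ℝ E3)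

theorem inner_grad (i : Fin 4) (x : E3) : ⟪grad T i, x⟫ = (T.coord i).linear x := by
  rw [grad, InnerProductSpace.toDual_symm_apply]; rfl

theorem coord_eq (i : Fin 4) (x : E3) : T.coord i x = ⟪grad T i, x⟫ + T.coord i 0 := by
  rw [inner_grad]
  exact congrFun (AffineMap.decomp (T.coord i : E3 →ᵃ[ℝ] ℝ)) x

theorem coord_add (i : Fin 4) (x v : E3) : T.coord i (x + v) = T.coord i x + ⟪grad T i, v⟫ := by
  rw [coord_eq T i (x + v), coord_eq T i x, inner_add_right]; ring

theorem hasFDerivAt_coord (i : Fin 4) (x : E3) :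
    HasFDerivAt (T.coord i) (innerSL ℝ (grad T i)) x := by
  have h : HasFDerivAt (fun x => ⟪grad T i, x⟫ + T.coord i 0) (innerSL ℝ (grad T i)) x :=
    (innerSL ℝ (grad T i)).hasFDerivAt.add_const _
  exact h.congr_of_eventuallyEq (Filter.Eventually.of_forall (coord_eq T i))

theorem sum_grad : ∑ i, grad T i = 0 := by
  refine ext_inner_right ℝ fun v => ?_
  have h1 := T.sum_coord_apply_eq_one (0 + v)
  simp only [coord_add, Finset.sum_add_distrib, T.sum_coord_apply_eq_one] at h1
  rw [sum_inner, inner_zero_left]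
  linarith

theorem eval_lam_bary (i : Fin 4) (x : E3) : eval (lam T x) (bary i) = T.coord i x :=
  eval_bary (y := fun i => T.coord i x) (T.sum_coord_apply_eq_one x) i

/-- The gradient of a polynomial in the barycentric coordinates. -/
noncomputable def gradPoly (p : Poly3) (x : E3) : E3 :=
  ∑ i : Fin 3, eval (lam T x) (pderiv i p) • grad T i.castSucc

theorem hasFDerivAt_eval_lam (p : Poly3) (x : E3) :
    HasFDerivAt (fun x => eval (lam T x) p) (innerSL ℝ (gradPoly T p x)) x := by
  induction p using MvPolynomial.induction_on with
  | C a => simpa [gradPoly] using hasFDerivAt_const a x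
  | add p q hp hq =>
    refine ((hp.fun_add hq).congr_fderiv ?_).congr_of_eventuallyEq (.of_forall fun y => by simp)
    rw [← map_add]
    simp [gradPoly, add_smul, Finset.sum_add_distrib]
  | mul_X p k hp =>
    refine ((hp.fun_mul (hasFDerivAt_coord T k.castSucc x)).congr_fderiv ?_).congr_of_eventuallyEq
      (.of_forall fun y => by simp [lam])
    rw [← map_smul, ← map_smul, ← map_add]
    congr 1
    simp only [gradPoly, Derivation.leibniz, smul_eq_mul, map_add, map_mul, eval_X, add_smul,
      Finset.sum_add_distrib, pderiv_X, Finset.smul_sum, smul_smul]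
    congr 1
    rw [Finset.sum_eq_single k]
    · simp
    · intro b _ hb
      simp [Pi.single_eq_of_ne hb.symm]
    · simp

theorem gradient_eval_lam (p : Poly3) (x : E3) :
    gradient (fun x => eval (lam T x) p) x = gradPoly T p x := by
  rw [gradient, (hasFDerivAt_eval_lam T p x).fderiv]
  exact (InnerProductSpace.toDual ℝ E3).symm_apply_apply _

theorem gradient_coord (i : Fin 4) (x : E3) : gradient (T.coord i) x = grad T i := by
  rw [gradient, (hasFDerivAt_coord T i x).fderiv]
  exact (InnerProductSpace.toDual ℝ E3).symm_apply_apply _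

theorem gradPoly_bary (i : Fin 4) (x : E3) : gradPoly T (bary i) x = grad T i := by
  rw [← gradient_eval_lam, ← gradient_coord T i x]
  congr 1
  funext y
  exact eval_lam_bary T i y

theorem bernstein_eq_eval (α : Fin 4 → ℕ) (x : E3) :
    bernstein T α x = eval (lam T x) (bernPoly α) := by
  simp [bernstein, bernPoly, baryMonomial, eval_lam_bary]

/-- The field with given covariant components. -/
noncomputable def covField (P : Fin 3 → Poly3) (x : E3) : E3 :=
  ∑ i : Fin 3, eval (lam T x) (P i) • grad T i.castSucc

/-- The basis of contravariant fields. -/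
noncomputable def faceVec : Fin 3 → E3 :=
  ![cross (grad T 1) (grad T 2), cross (grad T 2) (grad T 0), cross (grad T 0) (grad T 1)]

/-- The field with given contravariant components. -/
noncomputable def contraField (a : Fin 3 → Poly3) (x : E3) : E3 :=
  ∑ i : Fin 3, eval (lam T x) (a i) • faceVec T i

theorem cellBubble_eq_covField (m : ℕ) (ℓ : Fin 4) (α : Fin 4 → ℕ) :
    cellBubble T m ℓ α = covField T (bubblePoly m ℓ α) := by
  funext x
  have h1 : gradient (bernstein T α) x = gradPoly T (bernPoly α) x := by
    rw [← gradient_eval_lam]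
    congr 1
    funext y
    exact bernstein_eq_eval T α y
  rw [cellBubble, h1, gradient_coord, ← gradPoly_bary T ℓ x, bernstein_eq_eval, covField]
  simp only [gradPoly, bubblePoly, Finset.smul_sum, ← Finset.sum_sub_distrib, smul_smul, map_sub,
    map_mul, eval_C, sub_smul]

theorem hasFDerivAt_covField (P : Fin 3 → Poly3) (x : E3) :
    HasFDerivAt (covField T P)
      (∑ i : Fin 3, (innerSL ℝ (gradPoly T (P i) x)).smulRight (grad T i.castSucc)) x :=
  HasFDerivAt.fun_sum fun i _ => (hasFDerivAt_eval_lam T (P i) x).smul_const _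

theorem partialDeriv_covField (P : Fin 3 → Poly3) (i j : Fin 3) (x : E3) :
    partialDeriv (covField T P) i j x = ∑ k : Fin 3, ∑ l : Fin 3,
      eval (lam T x) (pderiv l (P k)) * grad T l.castSucc i * grad T k.castSucc j := by
  rw [partialDeriv, (hasFDerivAt_covField T P x).fderiv]
  simp [gradPoly, Fin.sum_univ_three, EuclideanSpace.inner_single_right]
  ring

/-- The ∇λᵢ are constant, so the curl of Pᵢ∇λᵢ is ∇Pᵢ × ∇λᵢ; antisymmetry collects these into the
three face vectors. -/
theorem curl_covField (P : Fin 3 → Poly3) :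
    curl (covField T P) = contraField T (curlPoly P) := by
  funext x
  ext j
  simp only [curl, partialDeriv_covField, contraField]
  fin_cases j <;>
  · simp [Fin.sum_univ_three, faceVec, curlPoly, cross, cross_apply]
    ring

theorem hasFDerivAt_contraField (P : Fin 3 → Poly3) (x : E3) :
    HasFDerivAt (contraField T P)
      (∑ i : Fin 3, (innerSL ℝ (gradPoly T (P i) x)).smulRight (faceVec T i)) x :=
  HasFDerivAt.fun_sum fun i _ => (hasFDerivAt_eval_lam T (P i) x).smul_const _

end BernsteinCurl

/-! ### Nondegeneracy of the frames and change of coordinates -/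

namespace BernsteinCurl

open MvPolynomial

variable (T : AffineBasis (Fin 4) ℝ E3)

theorem exists_coord_eq {w : Fin 4 → ℝ} (hw : ∑ i, w i = 1) : ∃ x, ∀ i, T.coord i x = w i :=
  ⟨Finset.univ.affineCombination ℝ T w, fun i =>
    T.coord_apply_combination_of_mem (Finset.mem_univ i) hw⟩

theorem exists_lam_eq (y : Fin 3 → ℝ) : ∃ x, lam T x = y := by
  obtain ⟨x, hx⟩ := exists_coord_eq T (w := ![y 0, y 1, y 2, 1 - y 0 - y 1 - y 2])
    (by simp [Fin.sum_univ_four])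
  refine ⟨x, ?_⟩
  funext i
  rw [lam, hx]
  fin_cases i <;> simp

theorem eq_zero_of_eval_lam {p : Poly3} (h : ∀ x, eval (lam T x) p = 0) : p = 0 := by
  refine MvPolynomial.funext fun y => ?_
  obtain ⟨x, rfl⟩ := exists_lam_eq T y
  rw [h, map_zero]

/-- The vectors are the edges from `T 3` to the other three vertices. -/
theorem exists_dual_edges : ∃ e : Fin 3 → E3, ∀ i j : Fin 3,
    ⟪grad T i.castSucc, e j⟫ = if i = j then 1 else 0 := by
  obtain ⟨x₀, h₀⟩ := exists_lam_eq T 0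
  choose x hx using fun j : Fin 3 => exists_lam_eq T (Pi.single j 1)
  refine ⟨fun j => x j - x₀, fun i j => ?_⟩
  have h1 := congrFun (hx j) i
  have h2 := congrFun h₀ i
  rw [lam, coord_eq] at h1 h2
  rw [inner_sub_right]
  simp only [Pi.single_apply, Pi.zero_apply] at h1 h2
  linarith

/-- The Jacobian determinant of the barycentric coordinates. -/
noncomputable def jac : ℝ := ⟪cross (grad T 1) (grad T 2), grad T 0⟫

theorem inner_eq_sum (x y : E3) : ⟪x, y⟫ = x 0 * y 0 + x 1 * y 1 + x 2 * y 2 := by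
  simp [PiLp.inner_apply, Fin.sum_univ_three]
  ring

theorem inner_faceVec (i j : Fin 3) :
    ⟪faceVec T i, grad T j.castSucc⟫ = if i = j then jac T else 0 := by
  fin_cases i <;> fin_cases j <;>
  · simp [faceVec, jac, inner_eq_sum, cross, cross_apply]
    try ring

/-- The matrix of gradients has the matrix of dual edges as its inverse. -/
theorem jac_ne_zero : jac T ≠ 0 := by
  obtain ⟨e, he⟩ := exists_dual_edges T
  set M : Matrix (Fin 3) (Fin 3) ℝ := Matrix.of fun i k => grad T i.castSucc k with hM
  set N : Matrix (Fin 3) (Fin 3) ℝ := Matrix.of fun k j => e j k with hN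
  have h1 : M * N = 1 := by
    ext i j
    rw [Matrix.mul_apply, Matrix.one_apply, ← he, inner_eq_sum, Fin.sum_univ_three]
    rfl
  have h2 : M.det * N.det = 1 := by rw [← Matrix.det_mul, h1, Matrix.det_one]
  have h3 : jac T = M.det := by
    rw [Matrix.det_fin_three]
    simp [hM, jac, inner_eq_sum, cross, cross_apply]
    ring
  rw [h3]
  exact left_ne_zero_of_mul_eq_one h2

/-- A translation that changes no barycentric coordinate is trivial; the fourth gradient is minus
the sum of the others. -/
theorem eq_zero_of_inner_grad {u : E3} (h : ∀ i : Fin 3, ⟪grad T i.castSucc, u⟫ = 0) : u = 0 := by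
  have h1 (i : Fin 4) : ⟪grad T i, u⟫ = 0 := by
    refine Fin.lastCases ?_ (fun j => h j) i
    have h2 := sum_grad T
    rw [Fin.sum_univ_castSucc] at h2
    rw [eq_neg_of_add_eq_zero_right h2, inner_neg_left, sum_inner]
    simp [h]
  have h2 : (0 : E3) + u = 0 := by
    refine T.ext_elem (k := ℝ) fun i => ?_
    rw [coord_add, h1, add_zero]
  simpa using h2

theorem eq_sum_faceVec (v : E3) :
    v = ∑ i : Fin 3, ((jac T)⁻¹ * ⟪v, grad T i.castSucc⟫) • faceVec T i := by
  rw [← sub_eq_zero]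
  refine eq_zero_of_inner_grad T fun j => ?_
  rw [real_inner_comm, inner_sub_left, sum_inner]
  simp only [inner_smul_left, inner_faceVec]
  simp
  have := jac_ne_zero T
  field_simp
  simp

theorem inner_contraField (a : Fin 3 → Poly3) (x : E3) (j : Fin 3) :
    ⟪contraField T a x, grad T j.castSucc⟫ = jac T * eval (lam T x) (a j) := by
  simp [contraField, sum_inner, inner_smul_left, inner_faceVec, mul_comm]

/-- Since ∇λ₃ = -(∇λ₀ + ∇λ₁ + ∇λ₂), the flux through the last face is governed by a₀ + a₁ + a₂. -/
theorem inner_contraField_three (a : Fin 3 → Poly3) (x : E3) :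
    ⟪contraField T a x, grad T 3⟫ = -(jac T * eval (lam T x) (a 0 + a 1 + a 2)) := by
  have h := sum_grad T
  rw [Fin.sum_univ_four] at h
  have h0 := inner_contraField T a x 0
  have h1 := inner_contraField T a x 1
  have h2 := inner_contraField T a x 2
  simp only [Fin.castSucc_zero, Fin.castSucc_one, Fin.reduceCastSucc] at h0 h1 h2
  rw [eq_neg_of_add_eq_zero_right h, inner_neg_right, inner_add_right, inner_add_right, h0, h1, h2,
    map_add, map_add]
  ring

theorem inner_covField (P : Fin 3 → Poly3) (x : E3) (j : Fin 3) :
    ⟪faceVec T j, covField T P x⟫ = jac T * eval (lam T x) (P j) := by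
  simp [covField, inner_sum, inner_smul_right, inner_faceVec, mul_comm]

/-- `contraField` as a linear map. -/
noncomputable def contraFieldLin : (Fin 3 → Poly3) →ₗ[ℝ] (E3 → E3) where
  toFun := contraField T
  map_add' a b := by
    funext x; simp [contraField, add_smul, Finset.sum_add_distrib]
  map_smul' c a := by
    funext x; simp [contraField, Finset.smul_sum, smul_smul]

/-- `covField` as a linear map. -/
noncomputable def covFieldLin : (Fin 3 → Poly3) →ₗ[ℝ] (E3 → E3) where
  toFun := covField T
  map_add' a b := by
    funext x; simp [covField, add_smul, Finset.sum_add_distrib]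
  map_smul' c a := by
    funext x; simp [covField, Finset.smul_sum, smul_smul]

theorem ker_contraFieldLin : LinearMap.ker (contraFieldLin T) = ⊥ := by
  rw [LinearMap.ker_eq_bot']
  intro a ha
  funext j
  refine eq_zero_of_eval_lam T fun x => ?_
  have h := inner_contraField T a x j
  have h2 : contraField T a x = 0 := congrFun ha x
  rw [h2, inner_zero_left] at h
  exact (mul_eq_zero.1 h.symm).resolve_left (jac_ne_zero T)

theorem ker_covFieldLin : LinearMap.ker (covFieldLin T) = ⊥ := by
  rw [LinearMap.ker_eq_bot']
  intro a ha
  funext j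
  refine eq_zero_of_eval_lam T fun x => ?_
  have h := inner_covField T a x j
  have h2 : covField T a x = 0 := congrFun ha x
  rw [h2, inner_zero_right] at h
  exact (mul_eq_zero.1 h.symm).resolve_left (jac_ne_zero T)

theorem curl_selectedBubble (n : ℕ) (p : selected n) :
    curl (selectedBubble T n p) =
      contraFieldLin T (curlPoly (bubblePoly (n + 1) p.1.1 p.1.2)) := by
  rw [selectedBubble, cellBubble_eq_covField, curl_covField]
  rfl

theorem linearIndependent_curl_selectedBubble (n : ℕ) :
    LinearIndependent ℝ (fun p => curl (selectedBubble T n p)) := by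
  simp only [curl_selectedBubble]
  exact (linearIndependent_curlPoly_bubblePoly n).map' _ (ker_contraFieldLin T)

/-- Vectors with independent images under a linear map, here the curl, are independent. -/
theorem linearIndependent_selectedBubble (n : ℕ) :
    LinearIndependent ℝ (selectedBubble T n) := by
  have h1 : LinearIndependent ℝ fun p : selected n => bubblePoly (n + 1) p.1.1 p.1.2 :=
    LinearIndependent.of_comp curlPoly (linearIndependent_curlPoly_bubblePoly n)
  have h2 : selectedBubble T n = covFieldLin T ∘ fun p => bubblePoly (n + 1) p.1.1 p.1.2 := by
    funext p
    exact cellBubble_eq_covField T _ _ _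
  rw [h2]
  exact h1.map' _ (ker_covFieldLin T)

theorem encard_range_selectedBubble (n : ℕ) :
    (range (selectedBubble T n)).encard = ((2 * (n + 1).choose 3 + n.choose 2 : ℕ) : ℕ∞) := by
  rw [← encard_selected, ← image_univ, (linearIndependent_selectedBubble T n).injective.encard_image,
    encard_univ, ENat.card_coe_set_eq]

/-- The barycentric coordinates as polynomials in the Cartesian ones. -/
noncomputable def lamPoly (j : Fin 3) : Poly3 :=
  C (T.coord j.castSucc 0) + ∑ k : Fin 3, C (grad T j.castSucc k) * X k

theorem eval_lamPoly (x : E3) (j : Fin 3) : eval (WithLp.ofLp x) (lamPoly T j) = lam T x j := by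
  rw [lam, coord_eq, inner_eq_sum]
  simp [lamPoly, Fin.sum_univ_three]
  ring

theorem totalDegree_affine_le (c : ℝ) (d : Fin 3 → ℝ) :
    (C c + ∑ k : Fin 3, C (d k) * X k : Poly3).totalDegree ≤ 1 := by
  refine (totalDegree_add _ _).trans (max_le (by simp) (totalDegree_finsetSum_le fun k _ => ?_))
  exact (totalDegree_mul _ _).trans (by simp)

theorem eval_bind₁_lamPoly (x : E3) (p : Poly3) :
    eval (WithLp.ofLp x) (bind₁ (lamPoly T) p) = eval (lam T x) p := by
  rw [eval_bind₁_eq]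
  simp only [eval_lamPoly]

theorem totalDegree_bind₁_lamPoly_le {n : ℕ} {p : Poly3} (hp : p.totalDegree ≤ n) :
    (bind₁ (lamPoly T) p).totalDegree ≤ n :=
  totalDegree_bind₁_le (fun _ => totalDegree_affine_le _ _) hp

theorem contraField_mem_polyVec {n : ℕ} {a : Fin 3 → Poly3} (ha : ∀ i, (a i).totalDegree ≤ n) :
    contraField T a ∈ polyVec n := by
  refine ⟨fun j => ∑ i : Fin 3, bind₁ (lamPoly T) (a i) * C (faceVec T i j), fun j => ?_, ?_⟩
  · refine totalDegree_finsetSum_le fun i _ => (totalDegree_mul _ _).trans ?_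
    simpa using totalDegree_bind₁_lamPoly_le T (ha i)
  · funext x
    ext j
    simp only [polyField, map_sum, map_mul, eval_C, eval_bind₁_lamPoly]
    simp [contraField, Fin.sum_univ_three]

theorem exists_eq_contraField {n : ℕ} {v : E3 → E3} (hv : v ∈ polyVec n) :
    ∃ a : Fin 3 → Poly3, (∀ i, (a i).totalDegree ≤ n) ∧ v = contraField T a := by
  obtain ⟨p, hp, rfl⟩ := hv
  obtain ⟨e, he⟩ := exists_dual_edges T
  obtain ⟨x₀, h₀⟩ := exists_lam_eq T 0
  -- The Cartesian coordinates as affine polynomials in the barycentric ones, via the dual edges.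
  set q : Fin 3 → Poly3 := fun k => C (x₀ k) + ∑ j : Fin 3, C (e j k) * X j with hq
  have hx (x : E3) : x = x₀ + ∑ j : Fin 3, lam T x j • e j := by
    rw [← sub_eq_zero]
    refine eq_zero_of_inner_grad T fun i => ?_
    have h1 : lam T x i = ⟪grad T i.castSucc, x⟫ + T.coord i.castSucc 0 := coord_eq T _ x
    have h2 : lam T x₀ i = ⟪grad T i.castSucc, x₀⟫ + T.coord i.castSucc 0 := coord_eq T _ x₀
    rw [inner_sub_right, inner_add_right, inner_sum]
    simp only [inner_smul_right, he]
    rw [h₀] at h2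
    simp at h2 ⊢
    linarith
  have hqx (x : E3) : (fun k => eval (lam T x) (q k)) = WithLp.ofLp x := by
    funext k
    conv_rhs => rw [hx x]
    simp [hq, Fin.sum_univ_three, mul_comm]
  refine ⟨fun i => C (jac T)⁻¹ * ∑ k : Fin 3, C (grad T i.castSucc k) * bind₁ q (p k),
    fun i => ?_, ?_⟩
  · refine (totalDegree_mul _ _).trans ?_
    rw [totalDegree_C, zero_add]
    refine totalDegree_finsetSum_le fun k _ => (totalDegree_mul _ _).trans ?_
    rw [totalDegree_C, zero_add]
    exact totalDegree_bind₁_le (fun _ => totalDegree_affine_le _ _) (hp k)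
  · funext x
    conv_lhs => rw [eq_sum_faceVec T (polyField p x)]
    refine Finset.sum_congr rfl fun i _ => ?_
    congr 1
    rw [inner_eq_sum]
    simp only [map_mul, eval_C, map_add, eval_bind₁_eq, hqx, Fin.sum_univ_three]
    simp only [polyField]
    ring

end BernsteinCurl

/-! ### Membership in the Nédélec space -/

namespace BernsteinCurl

open MvPolynomial

theorem polyField_add (p q : Fin 3 → Poly3) : polyField (p + q) = polyField p + polyField q := by
  funext x; ext i; simp [polyField]

theorem polyField_smul (c : ℝ) (p : Fin 3 → Poly3) : polyField (c • p) = c • polyField p := by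
  funext x; ext i; simp [polyField]

theorem cross_add (x y z : E3) : cross x (y + z) = cross x y + cross x z := by
  ext i; fin_cases i <;> simp [cross, cross_apply] <;> ring

theorem cross_smul (c : ℝ) (x y : E3) : cross x (c • y) = c • cross x y := by
  ext i; fin_cases i <;> simp [cross, cross_apply]

/-- The Nédélec space as a submodule. -/
noncomputable def nedelecSubmodule (n : ℕ) : Submodule ℝ (E3 → E3) where
  carrier := nedelec n
  add_mem' := by
    rintro - - ⟨-, ⟨p, hp, rfl⟩, -, ⟨q, hq, rfl⟩, rfl⟩ ⟨-, ⟨p', hp', rfl⟩, -, ⟨q', hq', rfl⟩, rfl⟩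
    refine ⟨_, ⟨p + p', fun i => (totalDegree_add _ _).trans (max_le (hp i) (hp' i)), rfl⟩,
      _, ⟨q + q', fun i => (hq i).add (hq' i), rfl⟩, ?_⟩
    funext x
    simp only [polyField_add, Pi.add_apply, cross_add]
    abel
  zero_mem' := by
    refine ⟨_, ⟨0, fun i => by simp, rfl⟩, _, ⟨0, fun i => isHomogeneous_zero _ _ _, rfl⟩, ?_⟩
    funext x
    ext i
    fin_cases i <;> simp [polyField, cross, cross_apply]
  smul_mem' := by
    rintro c - ⟨-, ⟨p, hp, rfl⟩, -, ⟨q, hq, rfl⟩, rfl⟩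
    refine ⟨_, ⟨c • p, fun i => (totalDegree_smul_le _ _).trans (hp i), rfl⟩,
      _, ⟨c • q, fun i => ?_, rfl⟩, ?_⟩
    · rw [Pi.smul_apply, smul_eq_C_mul]
      simpa using (isHomogeneous_C (Fin 3) c).mul (hq i)
    · funext x
      simp only [polyField_smul, Pi.smul_apply, cross_smul, smul_add]

theorem totalDegree_sub_homogeneousComponent_mul_le {n : ℕ} {p l : Poly3}
    (hp : p.totalDegree ≤ n) (hl : l.totalDegree ≤ 1) :
    ((p - homogeneousComponent n p) * l).totalDegree ≤ n := by
  have h (m : Fin 3 →₀ ℕ) (hm : m ∈ (p - homogeneousComponent n p).support) : m.degree + 1 ≤ n := by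
    rw [mem_support_iff, coeff_sub, coeff_homogeneousComponent] at hm
    split_ifs at hm with hd
    · simp at hm
    · have h1 : m.degree ≤ n := (le_totalDegree (mem_support_iff.2 (by simpa using hm))).trans hp
      omega
  by_cases h0 : p - homogeneousComponent n p = 0
  · simp [h0]
  -- A surviving monomial forces `1 ≤ n`, so `n - 1` below is a true predecessor.
  obtain ⟨m, hm⟩ := support_nonempty.2 h0
  have hn := h m hm
  have h1 : (p - homogeneousComponent n p).totalDegree ≤ n - 1 :=
    Finset.sup_le fun b hb => Nat.le_sub_one_of_lt (h b hb)
  exact (totalDegree_mul _ _).trans (by omega)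

/-- Only the part of `p` of degree exactly `n` can push `p • cross x d` to degree `n + 1`, and that
part lies in the second summand; the rest has degree at most `n`. -/
theorem smul_add_cross_mem_nedelec {n : ℕ} {p : Poly3} (hp : p.totalDegree ≤ n) (c d : E3) :
    (fun x : E3 => eval (WithLp.ofLp x) p • (c + cross x d)) ∈ nedelec n := by
  set r := p - homogeneousComponent n p with hr
  set l : Fin 3 → Poly3 := ![X 1 * C (d 2) - X 2 * C (d 1), X 2 * C (d 0) - X 0 * C (d 2),
    X 0 * C (d 1) - X 1 * C (d 0)] with hl
  have hld (i : Fin 3) : (l i).totalDegree ≤ 1 := by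
    have (j k : Fin 3) (b b' : ℝ) : (X j * C b - X k * C b' : Poly3).totalDegree ≤ 1 :=
      (totalDegree_sub _ _).trans
        (max_le ((totalDegree_mul _ _).trans (by simp)) ((totalDegree_mul _ _).trans (by simp)))
    fin_cases i <;> exact this _ _ _ _
  refine ⟨_, ⟨fun i => p * C (c i) + r * l i, fun i => ?_, rfl⟩,
    _, ⟨fun i => homogeneousComponent n p * C (d i), fun i => ?_, rfl⟩, ?_⟩
  · refine (totalDegree_add _ _).trans (max_le ((totalDegree_mul _ _).trans (by simpa using hp)) ?_)
    exact totalDegree_sub_homogeneousComponent_mul_le hp (hld i)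
  · simpa using (homogeneousComponent_isHomogeneous n p).mul (isHomogeneous_C (Fin 3) (d i))
  · funext x
    ext i
    fin_cases i <;>
    · simp [polyField, cross, cross_apply, hl, hr]
      ring

theorem cross_cross (x a b : E3) : cross x (cross a b) = ⟪b, x⟫ • a - ⟪a, x⟫ • b := by
  simp only [inner_eq_sum]
  ext i
  fin_cases i <;>
  · simp [cross, cross_apply]
    ring

theorem pderiv_baryMonomial (α : Fin 4 → ℕ) (i : Fin 3) :
    pderiv i (baryMonomial α) =
      ∑ j, C (α j : ℝ) * baryMonomial (α - Pi.single j 1) * pderiv i (bary j) := by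
  simp only [baryMonomial, Fin.prod_univ_four, Fin.sum_univ_four, pderiv_mul, pderiv_pow]
  simp
  ring

theorem totalDegree_bary_le (i : Fin 4) : (bary i).totalDegree ≤ 1 := by
  fin_cases i
  · simp [bary]
  · simp [bary]
  · simp [bary]
  · exact totalDegree_bary_three_le

theorem totalDegree_baryMonomial_le (β : Fin 4 → ℕ) : (baryMonomial β).totalDegree ≤ ∑ i, β i := by
  refine (totalDegree_finsetProd _ _).trans (Finset.sum_le_sum fun i _ => ?_)
  refine (totalDegree_pow _ _).trans ?_
  simpa using Nat.mul_le_mul_left (β i) (totalDegree_bary_le i)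

theorem sum_mul_multinomial_sub_single {α : Fin 4 → ℕ} {ℓ : Fin 4} (h : 0 < α ℓ) :
    (∑ i, α i) * Nat.multinomial Finset.univ (α - Pi.single ℓ 1) =
      α ℓ * Nat.multinomial Finset.univ α := by
  obtain ⟨β, rfl⟩ : ∃ β : Fin 4 → ℕ, α = β + Pi.single ℓ 1 := ⟨_, (sub_single_add_single h).symm⟩
  have h1 : β + Pi.single ℓ 1 - Pi.single ℓ 1 = β := by
    funext i; simp
  have h2 : ∏ i, ((β + Pi.single ℓ 1 : Fin 4 → ℕ) i).factorial = (β ℓ + 1) * ∏ i, (β i).factorial := by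
    fin_cases ℓ <;> simp [Fin.prod_univ_four, Nat.factorial_succ] <;> ring
  have h3 : ∑ i, (β + Pi.single ℓ 1 : Fin 4 → ℕ) i = ∑ i, β i + 1 := by
    simp [Finset.sum_add_distrib]
  have h4 := Nat.multinomial_spec Finset.univ (β + Pi.single ℓ 1)
  have h5 := Nat.multinomial_spec Finset.univ β
  rw [h2, h3, Nat.factorial_succ, ← h5] at h4
  have hpos : 0 < ∏ i, (β i).factorial := Finset.prod_pos fun i _ => Nat.factorial_pos _
  rw [h1, h3]
  apply Nat.eq_of_mul_eq_mul_left hpos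
  simp only [Pi.add_apply, Pi.single_eq_same]
  linarith

variable (T : AffineBasis (Fin 4) ℝ E3)

/-- The Whitney form expansion of the cell bubbles. -/
theorem cellBubble_eq_sum {m : ℕ} {α : Fin 4 → ℕ} (hα : ∑ i, α i = m + 1) {ℓ : Fin 4}
    (hℓ : 0 < α ℓ) (x : E3) :
    cellBubble T m ℓ α x = ((α ℓ : ℝ) * Nat.multinomial Finset.univ α / (m + 1)) •
      ∑ j, (α j : ℝ) • (eval (lam T x) (baryMonomial (α - Pi.single ℓ 1)) • grad T ℓ -
        eval (lam T x) (baryMonomial (α - Pi.single j 1)) • grad T j) := by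
  have hm : ((m : ℝ) + 1) ≠ 0 := by positivity
  have h1 : (((m : ℝ) + 1) * Nat.multinomial Finset.univ (α - Pi.single ℓ 1)) =
      α ℓ * Nat.multinomial Finset.univ α := by
    have := sum_mul_multinomial_sub_single hℓ
    rw [hα] at this
    exact_mod_cast this
  -- These weights distribute the single term with ∇λ_ℓ over all `j`, pairing it with the terms of
  -- the gradient.
  have h2 : ∑ j, (α j : ℝ) = m + 1 := by exact_mod_cast hα
  have hg : gradPoly T (bernPoly α) x = (Nat.multinomial Finset.univ α : ℝ) •
      ∑ j, (α j : ℝ) • eval (lam T x) (baryMonomial (α - Pi.single j 1)) • grad T j := by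
    simp_rw [← gradPoly_bary T _ x]
    simp only [gradPoly, bernPoly, pderiv_C_mul, pderiv_baryMonomial, map_mul, map_sum, eval_C,
      Finset.smul_sum, smul_smul]
    simp_rw [Finset.mul_sum, Finset.sum_smul]
    rw [Finset.sum_comm]
    refine Finset.sum_congr rfl fun i _ => Finset.sum_congr rfl fun j _ => ?_
    congr 1
    ring
  have h3 : gradient (bernstein T α) x = gradPoly T (bernPoly α) x := by
    rw [← gradient_eval_lam]
    congr 1
    funext y
    exact bernstein_eq_eval T α y
  rw [cellBubble, h3, hg, gradient_coord, bernstein_eq_eval, bernPoly, map_mul, eval_C]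
  simp only [smul_sub, Finset.sum_sub_distrib, ← Finset.sum_smul, h2]
  congr 1
  · rw [smul_smul, smul_smul, ← mul_assoc, h1]
    congr 1
    field_simp
  · rw [smul_smul]
    congr 1
    ring

/-- For j ≠ ℓ the difference in the expansion is λ^(α - e_ℓ - e_j) times the Whitney form λⱼ∇λ_ℓ -
λ_ℓ∇λⱼ, and the latter is a constant plus x × (∇λ_ℓ × ∇λⱼ). -/
theorem cellBubble_mem_nedelec {n : ℕ} (ℓ : Fin 4) {α : Fin 4 → ℕ}
    (hα : α ∈ interiorIndex (n + 2)) : cellBubble T (n + 1) ℓ α ∈ nedelec n := by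
  have h1 : cellBubble T (n + 1) ℓ α =
      ((α ℓ : ℝ) * Nat.multinomial Finset.univ α / ((n + 1 : ℕ) + 1)) •
      ∑ j, (α j : ℝ) • fun x => (eval (lam T x) (baryMonomial (α - Pi.single ℓ 1)) • grad T ℓ -
        eval (lam T x) (baryMonomial (α - Pi.single j 1)) • grad T j) := by
    funext x
    rw [cellBubble_eq_sum T hα.1 (hα.2 ℓ) x]
    simp
  rw [h1]
  refine (nedelecSubmodule n).smul_mem _ (Submodule.sum_mem _ fun j _ =>
    (nedelecSubmodule n).smul_mem _ ?_)
  by_cases hj : j = ℓ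
  · subst hj
    simp only [sub_self]
    exact (nedelecSubmodule n).zero_mem
  set β := α - Pi.single ℓ 1 - Pi.single j 1 with hβ
  have h2 : β + Pi.single j 1 = α - Pi.single ℓ 1 :=
    sub_single_add_single (by simpa [Pi.single_eq_of_ne hj] using hα.2 j)
  have h3 : α - Pi.single j 1 = β + Pi.single ℓ 1 := by
    have : β = α - Pi.single j 1 - Pi.single ℓ 1 := by
      rw [hβ, tsub_right_comm]
    rw [this, sub_single_add_single (by simpa [Pi.single_eq_of_ne (Ne.symm hj)] using hα.2 ℓ)]
  have hdeg : ∑ i, β i = n := by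
    have h4 : α = β + Pi.single j 1 + Pi.single ℓ 1 := by
      rw [h2, sub_single_add_single (hα.2 ℓ)]
    have h5 := hα.1
    rw [h4] at h5
    simp [Finset.sum_add_distrib] at h5
    omega
  have hp : (bind₁ (lamPoly T) (baryMonomial β)).totalDegree ≤ n :=
    totalDegree_bind₁_lamPoly_le T ((totalDegree_baryMonomial_le β).trans hdeg.le)
  change _ ∈ nedelec n
  convert smul_add_cross_mem_nedelec hp (T.coord j 0 • grad T ℓ - T.coord ℓ 0 • grad T j)
    (cross (grad T ℓ) (grad T j)) using 1
  funext x
  rw [← h2, h3, baryMonomial_add, baryMonomial_add, baryMonomial_single, baryMonomial_single,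
    map_mul, map_mul, eval_lam_bary, eval_lam_bary, eval_bind₁_lamPoly, cross_cross,
    coord_eq T j x, coord_eq T ℓ x]
  module

end BernsteinCurl

/-! ### The divergence theorem by cutoff -/

namespace BernsteinCurl

open Filter Topology

/-- The divergence of a vector field. -/
noncomputable def diverg (u : E3 → E3) (x : E3) : ℝ := ∑ i, partialDeriv u i i x

theorem continuous_partialDeriv {u : E3 → E3} (hu : ContDiff ℝ 1 u) (i j : Fin 3) :
    Continuous (partialDeriv u i j) := by
  have h1 : Continuous (fderiv ℝ u) := hu.continuous_fderiv one_ne_zero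
  unfold partialDeriv
  fun_prop

theorem continuous_diverg {u : E3 → E3} (hu : ContDiff ℝ 1 u) : Continuous (diverg u) :=
  continuous_finsetSum _ fun i _ => continuous_partialDeriv hu i i

theorem partialDeriv_eq_fderiv {u : E3 → E3} {x : E3} (hu : DifferentiableAt ℝ u x) (i j : Fin 3) :
    partialDeriv u i j x = fderiv ℝ (fun y => u y j) x (EuclideanSpace.single i 1) := by
  have h := ((EuclideanSpace.proj j : E3 →L[ℝ] ℝ).hasFDerivAt (x := u x)).comp x hu.hasFDerivAt
  have h2 : HasFDerivAt (fun y => u y j)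
      ((EuclideanSpace.proj j : E3 →L[ℝ] ℝ).comp (fderiv ℝ u x)) x := h
  rw [h2.fderiv]
  rfl

theorem integral_diverg_eq_zero {u : E3 → E3} (hu : ContDiff ℝ 1 u) (hc : HasCompactSupport u) :
    ∫ x, diverg u x = 0 := by
  have hd : Differentiable ℝ u := hu.differentiable one_ne_zero
  have hint (i j : Fin 3) : Integrable (partialDeriv u i j) := by
    refine (continuous_partialDeriv hu i j).integrable_of_hasCompactSupport ?_
    exact (hc.fderiv (𝕜 := ℝ)).comp_left
      (g := fun A : E3 →L[ℝ] E3 => A (EuclideanSpace.single i 1) j) (by simp)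
  unfold diverg
  rw [integral_finsetSum _ fun i _ => hint i i]
  refine Finset.sum_eq_zero fun i _ => ?_
  have hui : ContDiff ℝ 1 fun y => u y i := by fun_prop
  have hdi : Differentiable ℝ fun y => u y i := hui.differentiable one_ne_zero
  have hci : HasCompactSupport fun y => u y i := hc.comp_left (g := fun v : E3 => v i) rfl
  have hi0 : Integrable fun y => u y i := hui.continuous.integrable_of_hasCompactSupport hci
  have hi : Integrable fun x => fderiv ℝ (fun y => u y i) x (EuclideanSpace.single i 1) := by
    have h1 : partialDeriv u i i = _ := funext fun x => partialDeriv_eq_fderiv (hd x) i i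
    exact h1 ▸ hint i i
  -- Integration by parts against the constant function one.
  have h := integral_mul_fderiv_eq_neg_fderiv_mul_of_integrable (μ := volume) (𝕜 := ℝ)
    (f := fun _ : E3 => (1 : ℝ)) (g := fun y => u y i) (v := EuclideanSpace.single i 1)
    (by simp) (by simpa using hi)
    (by simpa using hi0) (fun x _ => differentiableAt_const (1 : ℝ)) (fun x _ => hdi x)
  simp only [partialDeriv_eq_fderiv (hd _)]
  simpa using h

variable (T : AffineBasis (Fin 4) ℝ E3)

theorem isCompact_tet : IsCompact (tet T) := (finite_range T).isCompact_convexHull ℝ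

theorem mem_tet_iff {x : E3} : x ∈ tet T ↔ ∀ i, 0 ≤ T.coord i x := by
  rw [tet, T.convexHull_eq_nonneg_coord]; rfl

theorem mem_interior_tet_iff {x : E3} : x ∈ interior (tet T) ↔ ∀ i, 0 < T.coord i x := by
  rw [tet, T.interior_convexHull]; rfl

/-- The boundary of a convex set is a null set. -/
theorem ae_tetVol_coord_pos : ∀ᵐ x ∂tetVol T, ∀ i, 0 < T.coord i x := by
  have h1 : volume (frontier (tet T)) = 0 := (convex_convexHull ℝ _).addHaar_frontier _
  have h2 : ∀ᵐ x ∂(volume : Measure E3), x ∉ frontier (tet T) := by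
    rw [ae_iff]; simpa using h1
  rw [tetVol]
  filter_upwards [ae_restrict_of_ae h2, ae_restrict_mem (isCompact_tet T).measurableSet] with x hx hxT
  rw [← mem_interior_tet_iff]
  rw [(isCompact_tet T).isClosed.frontier_eq] at hx
  exact not_not.1 fun h => hx ⟨hxT, h⟩

theorem integrable_tetVol {F : Type*} [NormedAddCommGroup F] {f : E3 → F} (hf : Continuous f) :
    Integrable f (tetVol T) :=
  hf.continuousOn.integrableOn_compact (isCompact_tet T)

instance : IsFiniteMeasure (tetVol T) :=
  ⟨by rw [tetVol, Measure.restrict_apply_univ]; exact (isCompact_tet T).measure_lt_top⟩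

theorem memLp_tetVol {F : Type*} [NormedAddCommGroup F] {f : E3 → F} (hf : Continuous f)
    (hF : AEStronglyMeasurable f (tetVol T)) : MemLp f 2 (tetVol T) := by
  obtain ⟨C, hC⟩ := (isCompact_tet T).exists_bound_of_continuousOn hf.continuousOn
  refine MemLp.of_bound hF C ?_
  filter_upwards [ae_restrict_mem (isCompact_tet T).measurableSet] with x hx using hC x hx

/-- The derivative vanishes outside [0, 1]. With s = kλᵢ - 1 the factor s + 1 is kλᵢ, so this bounds
the boundary-layer terms uniformly in k. -/
theorem exists_deriv_smoothTransition_bound :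
    ∃ C, ∀ s : ℝ, |deriv Real.smoothTransition s * (s + 1)| ≤ C := by
  have hd : Continuous (deriv Real.smoothTransition) :=
    (Real.smoothTransition.contDiff (n := 1)).continuous_deriv le_rfl
  obtain ⟨C, hC⟩ := (isCompact_Icc (a := (0 : ℝ)) (b := 1)).exists_bound_of_continuousOn
    (f := fun s => deriv Real.smoothTransition s * (s + 1)) (by fun_prop)
  refine ⟨max C 0, fun s => ?_⟩
  by_cases hs : s ∈ Icc (0 : ℝ) 1
  · exact (hC s hs).trans (le_max_left _ _)
  have h0 : deriv Real.smoothTransition s = 0 := by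
    rcases not_and_or.1 hs with h | h
    · have : Real.smoothTransition =ᶠ[𝓝 s] fun _ => 0 := by
        filter_upwards [Iio_mem_nhds (not_le.1 h)] with t ht
        exact Real.smoothTransition.zero_of_nonpos (le_of_lt ht)
      rw [this.deriv_eq, deriv_const]
    · have : Real.smoothTransition =ᶠ[𝓝 s] fun _ => 1 := by
        filter_upwards [Ioi_mem_nhds (not_le.1 h)] with t ht
        exact Real.smoothTransition.one_of_one_le (le_of_lt ht)
      rw [this.deriv_eq, deriv_const]
  simp [h0]

theorem deriv_smoothTransition_of_one_lt {s : ℝ} (hs : 1 < s) :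
    deriv Real.smoothTransition s = 0 := by
  have : Real.smoothTransition =ᶠ[𝓝 s] fun _ => 1 := by
    filter_upwards [Ioi_mem_nhds hs] with t ht
    exact Real.smoothTransition.one_of_one_le (le_of_lt ht)
  rw [this.deriv_eq, deriv_const]

/-- The factor of the cutoff function belonging to the `i`-th face. -/
noncomputable def cutoffFactor (k : ℕ) (i : Fin 4) (x : E3) : ℝ :=
  Real.smoothTransition (k * T.coord i x - 1)

/-- A smooth function supported in the interior of the tetrahedron and tending to one there. -/
noncomputable def cutoff (k : ℕ) (x : E3) : ℝ := ∏ i, cutoffFactor T k i x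

theorem contDiff_coord (i : Fin 4) {n : WithTop ℕ∞} : ContDiff ℝ n (T.coord i) := by
  have : ⇑(T.coord i) = fun x => ⟪grad T i, x⟫ + T.coord i 0 := funext (coord_eq T i)
  rw [this]
  exact (innerSL ℝ (grad T i)).contDiff.add contDiff_const

theorem continuous_coord (i : Fin 4) : Continuous (T.coord i) :=
  (contDiff_coord T i (n := 0)).continuous

theorem contDiff_cutoff (k : ℕ) : ContDiff ℝ 1 (cutoff T k) := by
  refine contDiff_prod fun i _ => ?_
  have h1 : ContDiff ℝ 1 fun x => (k : ℝ) * T.coord i x - 1 :=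
    (contDiff_const.mul (contDiff_coord T i)).sub contDiff_const
  exact (Real.smoothTransition.contDiff (n := 1)).comp h1

theorem hasFDerivAt_cutoffFactor (k : ℕ) (i : Fin 4) (x : E3) :
    HasFDerivAt (cutoffFactor T k i)
      ((deriv Real.smoothTransition (k * T.coord i x - 1) * k) • innerSL ℝ (grad T i)) x := by
  have h1 : HasFDerivAt (fun x => (k : ℝ) * T.coord i x - 1) ((k : ℝ) • innerSL ℝ (grad T i)) x :=
    ((hasFDerivAt_coord T i x).const_mul (k : ℝ)).sub_const 1
  have h2 : HasDerivAt Real.smoothTransition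
      (deriv Real.smoothTransition (k * T.coord i x - 1)) (k * T.coord i x - 1) :=
    ((Real.smoothTransition.contDiff (n := 1)).differentiable one_ne_zero _).hasDerivAt
  have h3 := h2.comp_hasFDerivAt x h1
  rwa [smul_smul] at h3

theorem hasFDerivAt_cutoff (k : ℕ) (x : E3) :
    HasFDerivAt (cutoff T k) (∑ i, (∏ j ∈ Finset.univ.erase i, cutoffFactor T k j x) •
      (deriv Real.smoothTransition (k * T.coord i x - 1) * k) • innerSL ℝ (grad T i)) x :=
  HasFDerivAt.finsetProd fun i _ => hasFDerivAt_cutoffFactor T k i x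

theorem cutoff_eq_zero {k : ℕ} {x : E3} (hx : x ∉ tet T) : cutoff T k x = 0 := by
  rw [mem_tet_iff] at hx
  push Not at hx
  obtain ⟨i, hi⟩ := hx
  refine Finset.prod_eq_zero (Finset.mem_univ i) (Real.smoothTransition.zero_of_nonpos ?_)
  have : (k : ℝ) * T.coord i x ≤ 0 := mul_nonpos_of_nonneg_of_nonpos (Nat.cast_nonneg k) hi.le
  linarith

theorem cutoffFactor_mem_Icc (k : ℕ) (i : Fin 4) (x : E3) : cutoffFactor T k i x ∈ Icc (0 : ℝ) 1 :=
  ⟨Real.smoothTransition.nonneg _, Real.smoothTransition.le_one _⟩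

theorem prod_cutoffFactor_abs_le (k : ℕ) (s : Finset (Fin 4)) (x : E3) :
    |∏ j ∈ s, cutoffFactor T k j x| ≤ 1 := by
  rw [abs_of_nonneg (Finset.prod_nonneg fun i _ => (cutoffFactor_mem_Icc T k i x).1)]
  exact Finset.prod_le_one (fun i _ => (cutoffFactor_mem_Icc T k i x).1)
    fun i _ => (cutoffFactor_mem_Icc T k i x).2

theorem sum_clm_single_mul (G : E3 →L[ℝ] ℝ) (v : E3) :
    ∑ i, G (EuclideanSpace.single i 1) * v i = G v := by
  have hv : v = ∑ i, v i • EuclideanSpace.single i (1 : ℝ) := by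
    ext j; fin_cases j <;> simp [Fin.sum_univ_three]
  conv_rhs => rw [hv, map_sum]
  exact Finset.sum_congr rfl fun i _ => by rw [map_smul, smul_eq_mul, mul_comm]

theorem diverg_smul {f : E3 → ℝ} {f' : E3 →L[ℝ] ℝ} {u : E3 → E3} {x : E3}
    (hf : HasFDerivAt f f' x) (hu : DifferentiableAt ℝ u x) :
    diverg (fun y => f y • u y) x = f x * diverg u x + f' (u x) := by
  have h := hf.smul hu.hasFDerivAt
  have h2 : fderiv ℝ (fun y => f y • u y) x = _ := h.fderiv
  simp only [diverg, partialDeriv, h2]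
  rw [← sum_clm_single_mul f', Finset.mul_sum, ← Finset.sum_add_distrib]
  refine Finset.sum_congr rfl fun i _ => ?_
  simp

/-- The divergence theorem on the tetrahedron for fields without normal trace. -/
theorem integral_tet_diverg_eq_zero {u : E3 → E3} (hu : ContDiff ℝ 1 u) {b : Fin 4 → E3 → ℝ}
    (hb : ∀ i, Continuous (b i)) (hub : ∀ i x, ⟪grad T i, u x⟫ = T.coord i x * b i x) :
    ∫ x, diverg u x ∂(tetVol T) = 0 := by
  obtain ⟨C, hC⟩ := exists_deriv_smoothTransition_bound
  have hdu : Differentiable ℝ u := hu.differentiable one_ne_zero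
  set E : ℕ → E3 → ℝ := fun k x => diverg (fun y => cutoff T k y • u y) x with hE
  have hEu (k : ℕ) : ContDiff ℝ 1 fun y => cutoff T k y • u y := (contDiff_cutoff T k).smul hu
  -- The chain rule produces a factor k, and ∇λᵢ · u = λᵢbᵢ a factor λᵢ; together they give the
  -- bounded quantity above.
  have hEf (k : ℕ) (x : E3) : E k x = cutoff T k x * diverg u x +
      ∑ i, (∏ j ∈ Finset.univ.erase i, cutoffFactor T k j x) *
        (deriv Real.smoothTransition (k * T.coord i x - 1) * (k * T.coord i x - 1 + 1)) *
          b i x := by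
    rw [hE]
    dsimp only
    rw [diverg_smul (hasFDerivAt_cutoff T k x) (hdu x)]
    congr 1
    simp only [sum_apply, smul_apply, innerSL_apply_apply,
      hub, smul_eq_mul]
    exact Finset.sum_congr rfl fun i _ => by ring
  have hE0 (k : ℕ) : ∫ x, E k x ∂(tetVol T) = 0 := by
    have hsupp : tsupport (fun y => cutoff T k y • u y) ⊆ tet T := by
      refine closure_minimal (fun x hx => ?_) (isCompact_tet T).isClosed
      by_contra hxT
      exact hx (by simp [cutoff_eq_zero T hxT])
    rw [tetVol, setIntegral_eq_integral_of_forall_compl_eq_zero]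
    · exact integral_diverg_eq_zero (hEu k)
        (HasCompactSupport.intro (isCompact_tet T) fun x hx => by simp [cutoff_eq_zero T hx])
    · intro x hx
      simp [hE, diverg, partialDeriv, fderiv_of_notMem_tsupport ℝ fun h => hx (hsupp h)]
  have hlim : Tendsto (fun k => ∫ x, E k x ∂(tetVol T)) atTop (𝓝 (∫ x, diverg u x ∂(tetVol T))) := by
    refine tendsto_integral_of_dominated_convergence
      (fun x => |diverg u x| + ∑ i, C * |b i x|)
      (fun k => (continuous_diverg (hEu k)).aestronglyMeasurable) ?_ ?_ ?_
    · refine integrable_tetVol T ?_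
      have := continuous_diverg hu
      fun_prop
    · intro k
      refine Eventually.of_forall fun x => ?_
      rw [hEf, Real.norm_eq_abs]
      refine (abs_add_le _ _).trans (add_le_add ?_ ?_)
      · rw [abs_mul]
        exact mul_le_of_le_one_left (abs_nonneg _) (prod_cutoffFactor_abs_le T k _ x)
      · refine (Finset.abs_sum_le_sum_abs _ _).trans (Finset.sum_le_sum fun i _ => ?_)
        rw [abs_mul, abs_mul]
        refine mul_le_mul_of_nonneg_right ?_ (abs_nonneg _)
        exact (mul_le_of_le_one_left (abs_nonneg _) (prod_cutoffFactor_abs_le T k _ x)).trans (hC _)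
    · filter_upwards [ae_tetVol_coord_pos T] with x hx
      -- At an interior point every kλᵢ - 1 eventually exceeds one, where the cutoff is locally
      -- constant.
      refine tendsto_const_nhds.congr' ?_
      have h1 : ∀ᶠ k : ℕ in atTop, ∀ i, 1 < (k : ℝ) * T.coord i x - 1 := by
        rw [eventually_all]
        intro i
        have h2 : Tendsto (fun k : ℕ => (k : ℝ) * T.coord i x) atTop atTop :=
          tendsto_natCast_atTop_atTop.atTop_mul_const (hx i)
        filter_upwards [h2.eventually_gt_atTop 2] with k hk
        linarith
      filter_upwards [h1] with k hk
      have h3 : cutoff T k x = 1 :=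
        Finset.prod_eq_one fun i _ => Real.smoothTransition.one_of_one_le (hk i).le
      rw [hEf, h3, one_mul]
      simp only [deriv_smoothTransition_of_one_lt (hk _), zero_mul, mul_zero,
        Finset.sum_const_zero, add_zero]
  simp only [hE0] at hlim
  exact (tendsto_nhds_unique hlim tendsto_const_nhds)

end BernsteinCurl

/-! ### Green's formulas and the weak boundary conditions -/

namespace BernsteinCurl

open Filter Topology MvPolynomial

variable (T : AffineBasis (Fin 4) ℝ E3)

theorem contDiff_eval_lam (p : Poly3) {n : WithTop ℕ∞} :
    ContDiff ℝ n fun x => eval (lam T x) p := by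
  induction p using MvPolynomial.induction_on with
  | C a => simpa using contDiff_const
  | add p q hp hq => simpa using hp.add hq
  | mul_X p k hp => simpa [lam] using hp.mul (contDiff_coord T k.castSucc)

theorem contDiff_covField (P : Fin 3 → Poly3) {n : WithTop ℕ∞} : ContDiff ℝ n (covField T P) :=
  ContDiff.sum fun i _ => (contDiff_eval_lam T (P i)).smul contDiff_const

theorem contDiff_contraField (P : Fin 3 → Poly3) {n : WithTop ℕ∞} :
    ContDiff ℝ n (contraField T P) :=
  ContDiff.sum fun i _ => (contDiff_eval_lam T (P i)).smul contDiff_const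

theorem continuous_eval_lam (p : Poly3) : Continuous fun x => eval (lam T x) p :=
  (contDiff_eval_lam T p (n := 0)).continuous

theorem continuous_contraField (P : Fin 3 → Poly3) : Continuous (contraField T P) :=
  (contDiff_contraField T P (n := 0)).continuous

theorem continuous_covField (P : Fin 3 → Poly3) : Continuous (covField T P) :=
  (contDiff_covField T P (n := 0)).continuous

theorem contDiff_cross {v w : E3 → E3} {n : WithTop ℕ∞} (hv : ContDiff ℝ n v)
    (hw : ContDiff ℝ n w) : ContDiff ℝ n fun x => cross (v x) (w x) := by
  rw [contDiff_euclidean]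
  intro i
  fin_cases i <;>
  · simp [cross, cross_apply]
    fun_prop

/-- The divergence of a cross product. -/
theorem diverg_cross {v w : E3 → E3} {x : E3} (hv : Differentiable ℝ v) (hw : Differentiable ℝ w) :
    diverg (fun y => cross (v y) (w y)) x = ⟪curl v x, w x⟫ - ⟪v x, curl w x⟫ := by
  have hc : Differentiable ℝ fun y => cross (v y) (w y) := by
    rw [differentiable_euclidean]
    intro i
    fin_cases i <;>
    · simp [cross, cross_apply]
      fun_prop
  have hvi (i : Fin 3) : DifferentiableAt ℝ (fun y => v y i) x := by fun_prop
  have hwi (i : Fin 3) : DifferentiableAt ℝ (fun y => w y i) x := by fun_prop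
  have key (i j k : Fin 3) : fderiv ℝ (fun y => v y j * w y k - v y k * w y j) x
      (EuclideanSpace.single i 1) = v x j * partialDeriv w i k x + partialDeriv v i j x * w x k -
        (v x k * partialDeriv w i j x + partialDeriv v i k x * w x j) := by
    have h := ((hvi j).hasFDerivAt.fun_mul (hwi k).hasFDerivAt).fun_sub
      ((hvi k).hasFDerivAt.fun_mul (hwi j).hasFDerivAt)
    rw [h.fderiv]
    simp only [partialDeriv_eq_fderiv (hv x), partialDeriv_eq_fderiv (hw x), sub_apply, add_apply,
      smul_apply, smul_eq_mul]
    ring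
  have h0 : partialDeriv (fun y => cross (v y) (w y)) 0 0 x = _ :=
    (partialDeriv_eq_fderiv (hc x) 0 0).trans (key 0 1 2)
  have h1 : partialDeriv (fun y => cross (v y) (w y)) 1 1 x = _ :=
    (partialDeriv_eq_fderiv (hc x) 1 1).trans (key 1 2 0)
  have h2 : partialDeriv (fun y => cross (v y) (w y)) 2 2 x = _ :=
    (partialDeriv_eq_fderiv (hc x) 2 2).trans (key 2 0 1)
  rw [diverg, Fin.sum_univ_three, h0, h1, h2, inner_eq_sum, inner_eq_sum]
  simp [curl]
  ring

theorem inner_cross_right (a b c : E3) : ⟪a, cross b c⟫ = ⟪cross a b, c⟫ := by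
  simp [inner_eq_sum, cross, cross_apply]
  ring

/-- Green's formula for fields whose tangential component vanishes on the faces. -/
theorem integral_curl_sub_eq_zero (P : Fin 3 → Poly3) {B : Fin 4 → E3 → E3}
    (hB : ∀ i, Continuous (B i))
    (hPB : ∀ i x, cross (grad T i) (covField T P x) = T.coord i x • B i x)
    {φ : E3 → E3} (hφ : ContDiff ℝ ∞ φ) :
    ∫ x, ⟪curl (covField T P) x, φ x⟫ ∂(tetVol T) - ∫ x, ⟪covField T P x, curl φ x⟫ ∂(tetVol T)
      = 0 := by
  have hφ1 : ContDiff ℝ 1 φ := hφ.of_le (by exact_mod_cast le_top)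
  have hcφ : Continuous (curl φ) := by
    have := continuous_partialDeriv hφ1
    rw [show curl φ = fun x => WithLp.toLp 2 ![partialDeriv φ 1 2 x - partialDeriv φ 2 1 x,
     partialDeriv φ 2 0 x - partialDeriv φ 0 2 x,
     partialDeriv φ 0 1 x - partialDeriv φ 1 0 x] from rfl]
    refine (PiLp.continuous_toLp 2 _).comp (continuous_pi fun i => ?_)
    fin_cases i <;>
    · simp
      exact (this _ _).sub (this _ _)
  have hv := contDiff_covField T P (n := 1)
  rw [← integral_sub]
  · simp_rw [← diverg_cross (hv.differentiable one_ne_zero) (hφ1.differentiable one_ne_zero)]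
    -- The normal component of v × φ is (∇λᵢ × v) · φ, which vanishes on the face λᵢ = 0.
    refine integral_tet_diverg_eq_zero T (contDiff_cross hv hφ1)
      (b := fun i x => ⟪B i x, φ x⟫) (fun i => (hB i).inner hφ.continuous) fun i x => ?_
    rw [inner_cross_right, hPB, real_inner_smul_left]
  · rw [curl_covField]
    exact integrable_tetVol T ((continuous_contraField T _).inner hφ.continuous)
  · exact integrable_tetVol T ((continuous_covField T P).inner hcφ)

theorem memLp_two_tetVol {f : E3 → E3} (hf : Continuous f) : MemLp f 2 (tetVol T) :=
  memLp_tetVol T hf hf.aestronglyMeasurable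

theorem covField_mem_H0curl (P : Fin 3 → Poly3) {B : Fin 4 → E3 → E3}
    (hB : ∀ i, Continuous (B i))
    (hPB : ∀ i x, cross (grad T i) (covField T P x) = T.coord i x • B i x) :
    covField T P ∈ H0curl T := by
  have h1 : MemLp (curl (covField T P)) 2 (tetVol T) := by
    rw [curl_covField]; exact memLp_two_tetVol T (continuous_contraField T _)
  have h2 : HasWeakCurl T (covField T P) (curl (covField T P)) := fun φ hφ _ _ =>
    (sub_eq_zero.1 (integral_curl_sub_eq_zero T P hB hPB hφ)).symm
  exact ⟨⟨memLp_two_tetVol T (continuous_covField T P), _, h1, h2⟩, _, h1, h2,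
    fun φ hφ => integral_curl_sub_eq_zero T P hB hPB hφ⟩

theorem cross_self (a : E3) : cross a a = 0 := by
  simp [cross]

theorem cross_sub (x y z : E3) : cross x (y - z) = cross x y - cross x z := by
  ext i; fin_cases i <;> simp [cross, cross_apply] <;> ring

theorem cross_sum {ι : Type*} (s : Finset ι) (x : E3) (f : ι → E3) :
    cross x (∑ j ∈ s, f j) = ∑ j ∈ s, cross x (f j) :=
  map_sum (⟨⟨cross x, cross_add x⟩, fun c y => cross_smul c x y⟩ : E3 →ₗ[ℝ] E3) f s

/-- In the Whitney expansion each ∇λᵢ × (λ^(α - e_j) ∇λⱼ) is a multiple of λᵢ: for i = j the cross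
product is zero, otherwise αᵢ > 0 leaves a factor λᵢ in the monomial. -/
theorem cellBubble_mem_H0curl {m : ℕ} (ℓ : Fin 4) {α : Fin 4 → ℕ}
    (hα : α ∈ interiorIndex (m + 1)) : cellBubble T m ℓ α ∈ H0curl T := by
  have hD (i j : Fin 4) : ∃ D : E3 → E3, Continuous D ∧ ∀ x,
      cross (grad T i) (eval (lam T x) (baryMonomial (α - Pi.single j 1)) • grad T j) =
        T.coord i x • D x := by
    by_cases hij : i = j
    · subst hij
      exact ⟨fun _ => 0, continuous_const, fun x => by rw [cross_smul, cross_self]; simp⟩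
    · obtain ⟨q, hq⟩ := bary_dvd_baryMonomial_sub hij (hα.2 i)
      refine ⟨fun x => eval (lam T x) q • cross (grad T i) (grad T j),
        (continuous_eval_lam T q).smul continuous_const, fun x => ?_⟩
      rw [hq, map_mul, eval_lam_bary, cross_smul, mul_smul]
  choose D hDc hD using hD
  have hc := cellBubble_eq_covField T m ℓ α
  rw [hc]
  refine covField_mem_H0curl T _
    (B := fun i x => ((α ℓ : ℝ) * Nat.multinomial Finset.univ α / (m + 1)) •
      ∑ j, (α j : ℝ) • (D i ℓ x - D i j x)) (fun i => ?_) fun i x => ?_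
  · have := fun j => hDc i j
    fun_prop
  · rw [← hc, cellBubble_eq_sum T hα.1 (hα.2 ℓ) x, cross_smul, cross_sum,
      smul_comm (T.coord i x)]
    congr 1
    rw [Finset.smul_sum]
    refine Finset.sum_congr rfl fun j _ => ?_
    rw [cross_smul, cross_sub, hD, hD, smul_comm (T.coord i x), smul_sub (T.coord i x)]

/-- The face vectors are dual to the gradients up to `jac`, so only the diagonal derivatives ∂ₖaₖ
survive. -/
theorem diverg_contraField (a : Fin 3 → Poly3) (x : E3) :
    diverg (contraField T a) x = jac T * eval (lam T x) (divPoly a) := by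
  have h (k l : Fin 3) := inner_faceVec T k l
  have hp (i : Fin 3) : partialDeriv (contraField T a) i i x = ∑ k : Fin 3, ∑ l : Fin 3,
      eval (lam T x) (pderiv l (a k)) * (faceVec T k i * grad T l.castSucc i) := by
    rw [partialDeriv, (hasFDerivAt_contraField T a x).fderiv]
    simp [gradPoly, Fin.sum_univ_three, EuclideanSpace.inner_single_right]
    ring
  have h2 (k l : Fin 3) : ∑ i : Fin 3, eval (lam T x) (pderiv l (a k)) *
      (faceVec T k i * grad T l.castSucc i) =
      eval (lam T x) (pderiv l (a k)) * if k = l then jac T else 0 := by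
    rw [← h, inner_eq_sum, Fin.sum_univ_three]; ring
  have h3 : diverg (contraField T a) x = ∑ k : Fin 3, ∑ l : Fin 3, ∑ i : Fin 3,
      eval (lam T x) (pderiv l (a k)) * (faceVec T k i * grad T l.castSucc i) := by
    simp only [diverg, hp, Fin.sum_univ_three]
    ring
  rw [h3]
  simp_rw [h2]
  simp [Fin.sum_univ_three, divPoly]
  ring

/-- Green's formula for divergence-free fields whose normal component vanishes on the faces. -/
theorem integral_inner_gradient_eq_zero {a : Fin 3 → Poly3} (hdiv : divPoly a = 0)
    (hX : ∀ i, X i ∣ a i) (hw : bary 3 ∣ a 0 + a 1 + a 2) {φ : E3 → ℝ} (hφ : ContDiff ℝ ∞ φ) :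
    ∫ x, ⟪contraField T a x, gradient φ x⟫ ∂(tetVol T) = 0 := by
  have hφ1 : ContDiff ℝ 1 φ := hφ.of_le (by exact_mod_cast le_top)
  have hv := contDiff_contraField T a (n := 1)
  have hb (i : Fin 4) : ∃ b : E3 → ℝ, Continuous b ∧
      ∀ x, ⟪contraField T a x, grad T i⟫ = T.coord i x * b x := by
    refine Fin.lastCases ?_ (fun j => ?_) i
    · obtain ⟨q, hq⟩ := hw
      refine ⟨fun x => -(jac T * eval (lam T x) q), ?_, fun x => ?_⟩
      · exact (continuous_const.mul (continuous_eval_lam T q)).neg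
      · change ⟪contraField T a x, grad T 3⟫ = T.coord 3 x * _
        rw [inner_contraField_three, hq, map_mul, eval_lam_bary]
        ring
    · obtain ⟨q, hq⟩ := hX j
      refine ⟨fun x => jac T * eval (lam T x) q, ?_, fun x => ?_⟩
      · exact continuous_const.mul (continuous_eval_lam T q)
      · rw [inner_contraField, hq, map_mul, eval_X, lam]
        ring
  choose b hbc hb using hb
  have h := integral_tet_diverg_eq_zero T (u := fun x => φ x • contraField T a x) (hφ1.smul hv)
    (b := fun i x => φ x * b i x) (fun i => hφ.continuous.mul (hbc i)) fun i x => by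
      rw [real_inner_smul_right, real_inner_comm, hb]; ring
  rw [← h]
  congr 1
  funext x
  have hd : DifferentiableAt ℝ φ x := hφ1.differentiable one_ne_zero x
  rw [diverg_smul hd.hasFDerivAt (hv.differentiable one_ne_zero x), diverg_contraField, hdiv,
    map_zero, mul_zero, mul_zero, zero_add, gradient, real_inner_comm,
    InnerProductSpace.toDual_symm_apply]

theorem contraField_mem_H0divFree {a : Fin 3 → Poly3} (hdiv : divPoly a = 0)
    (hX : ∀ i, X i ∣ a i) (hw : bary 3 ∣ a 0 + a 1 + a 2) : contraField T a ∈ H0divFree T := by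
  have h1 : HasWeakDiv T (contraField T a) 0 := fun φ hφ _ _ => by
    rw [integral_inner_gradient_eq_zero T hdiv hX hw hφ]; simp
  have h2 : MemLp (0 : E3 → ℝ) 2 (tetVol T) := MemLp.zero
  exact ⟨⟨⟨memLp_two_tetVol T (continuous_contraField T a), 0, h2, h1⟩, 0, h2, h1, fun φ hφ => by
    rw [integral_inner_gradient_eq_zero T hdiv hX hw hφ]; simp⟩, h1⟩

theorem divPoly_curlPoly (P : Fin 3 → Poly3) : divPoly (curlPoly P) = 0 := by
  simp only [divPoly, curlPoly, LinearMap.coe_mk, AddHom.coe_mk, Matrix.cons_val, map_sub]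
  rw [pderiv_comm 1 0 (P 2), pderiv_comm 2 0 (P 1), pderiv_comm 2 1 (P 0)]
  ring

theorem X_dvd_curlPoly {P : Fin 3 → Poly3} (hP : ∀ i j : Fin 3, i ≠ j → X i ∣ P j) (i : Fin 3) :
    X i ∣ curlPoly P i := by
  fin_cases i
  · exact dvd_sub (X_dvd_pderiv (by decide) (hP 0 2 (by decide)))
      (X_dvd_pderiv (by decide) (hP 0 1 (by decide)))
  · exact dvd_sub (X_dvd_pderiv (by decide) (hP 1 0 (by decide)))
      (X_dvd_pderiv (by decide) (hP 1 2 (by decide)))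
  · exact dvd_sub (X_dvd_pderiv (by decide) (hP 2 1 (by decide)))
      (X_dvd_pderiv (by decide) (hP 2 0 (by decide)))

/-- All partial derivatives of λ₃ equal -1, so in the sum of the components of the curl the terms
where λ₃ is differentiated cancel. -/
theorem bary_three_dvd_sum_curlPoly {P : Fin 3 → Poly3} (hP : ∀ j, bary 3 ∣ P j) :
    bary 3 ∣ curlPoly P 0 + curlPoly P 1 + curlPoly P 2 := by
  choose Q hQ using hP
  have hd (i : Fin 3) : pderiv i (bary 3) = -1 := by
    fin_cases i <;> simp [bary, pderiv_X]
  simp only [curlPoly, LinearMap.coe_mk, AddHom.coe_mk, Matrix.cons_val, hQ, pderiv_mul, hd]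
  exact ⟨pderiv 1 (Q 2) - pderiv 2 (Q 1) + (pderiv 2 (Q 0) - pderiv 0 (Q 2)) +
    (pderiv 0 (Q 1) - pderiv 1 (Q 0)), by ring⟩

theorem bary_dvd_monoBubble {n : ℕ} {p : Fin 4 × (Fin 4 → ℕ)} (hp : p ∈ selected n) (i : Fin 4)
    (j : Fin 3) (hij : i ≠ j.castSucc) : bary i ∣ monoBubble p.1 p.2 j := by
  by_cases h : p.1 = j.castSucc
  · rw [h, monoBubble_castSucc]
    exact bary_dvd_baryMonomial_sub hij (hp.1.2 i)
  · rw [monoBubble_apply_of_ne (ne_three_of_mem_selected hp) h]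
    exact dvd_zero _

theorem totalDegree_curlPoly_le {n : ℕ} {P : Fin 3 → Poly3}
    (hP : ∀ i, (P i).totalDegree ≤ n + 1) (i : Fin 3) : (curlPoly P i).totalDegree ≤ n := by
  fin_cases i <;>
  exact (totalDegree_sub _ _).trans
    (max_le (totalDegree_pderiv_le _ (hP _)) (totalDegree_pderiv_le _ (hP _)))

/-- Polynomial coefficients of divergence-free fields without normal trace. -/
noncomputable def admissible (n : ℕ) : Submodule ℝ (Fin 3 → Poly3) where
  carrier := {a | (∀ i, (a i).totalDegree ≤ n) ∧ divPoly a = 0 ∧ (∀ i, X i ∣ a i) ∧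
    bary 3 ∣ a 0 + a 1 + a 2}
  zero_mem' := ⟨fun i => by simp, by simp [divPoly], fun i => dvd_zero _, by simp⟩
  add_mem' := by
    rintro a b ⟨ha, ha1, ha2, ha3⟩ ⟨hb, hb1, hb2, hb3⟩
    refine ⟨fun i => (totalDegree_add _ _).trans (max_le (ha i) (hb i)), ?_,
      fun i => dvd_add (ha2 i) (hb2 i), ?_⟩
    · have : divPoly (a + b) = divPoly a + divPoly b := by
        simp only [divPoly, Pi.add_apply, map_add]
        ring
      rw [this, ha1, hb1, add_zero]
    · have h := dvd_add ha3 hb3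
      rwa [show a 0 + a 1 + a 2 + (b 0 + b 1 + b 2) = (a + b) 0 + (a + b) 1 + (a + b) 2 by
        simp only [Pi.add_apply]; ring] at h
  smul_mem' := by
    rintro c a ⟨ha, ha1, ha2, ha3⟩
    refine ⟨fun i => (totalDegree_smul_le _ _).trans (ha i), ?_, fun i => ?_, ?_⟩
    · have : divPoly (c • a) = c • divPoly a := by
        simp only [divPoly, Pi.smul_apply, Derivation.map_smul, smul_add]
      rw [this, ha1, smul_zero]
    · rw [Pi.smul_apply, smul_eq_C_mul]
      exact (ha2 i).mul_left _
    · have h := ha3.mul_left (C c)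
      rwa [show C c * (a 0 + a 1 + a 2) = (c • a) 0 + (c • a) 1 + (c • a) 2 by
        simp only [Pi.smul_apply, smul_eq_C_mul]; ring] at h

theorem curlPoly_monoBubble_mem_admissible {n : ℕ} (p : selected n) :
    curlPoly (monoBubble p.1.1 p.1.2) ∈ admissible n := by
  have hd := fun i j hij => bary_dvd_monoBubble p.2 i j hij
  have hX (i j : Fin 3) (hij : i ≠ j) : X i ∣ monoBubble p.1.1 p.1.2 j := by
    have h := hd i.castSucc j fun h => hij (Fin.castSucc_injective _ h)
    have hb : bary i.castSucc = X i := by fin_cases i <;> simp [bary]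
    rwa [hb] at h
  refine ⟨totalDegree_curlPoly_le fun i => ?_, divPoly_curlPoly _, X_dvd_curlPoly hX,
    bary_three_dvd_sum_curlPoly fun j => hd 3 j (by fin_cases j <;> decide)⟩
  by_cases h : p.1.1 = i.castSucc
  · rw [h, monoBubble_castSucc]
    refine (totalDegree_baryMonomial_le _).trans ?_
    have h1 := p.2.1.1
    rw [← sub_single_add_single (p.2.1.2 i.castSucc)] at h1
    simp [Finset.sum_add_distrib] at h1
    simp
    omega
  · rw [monoBubble_apply_of_ne (ne_three_of_mem_selected p.2) h]
    simp

theorem span_curlPoly_bubblePoly (n : ℕ) :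
    Submodule.span ℝ (range fun p : selected n => curlPoly (bubblePoly (n + 1) p.1.1 p.1.2)) =
      admissible n := by
  refine le_antisymm (Submodule.span_le.2 ?_) fun a ha =>
    mem_span_curlPoly_bubblePoly ha.1 ha.2.1 ha.2.2.1 ha.2.2.2
  rintro _ ⟨p, rfl⟩
  dsimp only
  rw [curlPoly_bubblePoly]
  exact (admissible n).smul_mem _ (curlPoly_monoBubble_mem_admissible p)

end BernsteinCurl

/-! ### From weak conditions back to polynomial identities; conclusion -/

namespace BernsteinCurl

open Filter Topology MvPolynomial

variable (T : AffineBasis (Fin 4) ℝ E3)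

/-- The weak formulation of the normal trace for divergence-free fields. -/
theorem integral_inner_gradient_eq_zero_of_mem_H0divFree {v : E3 → E3} (hv : v ∈ H0divFree T)
    {φ : E3 → ℝ} (hφ : ContDiff ℝ ∞ φ) : ∫ x, ⟪v x, gradient φ x⟫ ∂(tetVol T) = 0 := by
  obtain ⟨⟨-, g, hg, hgw, hgt⟩, h0⟩ := hv
  have hgi : Integrable g (tetVol T) := hg.integrable (by norm_num)
  -- The trace condition comes with its own weak divergence `g`; by uniqueness it vanishes almost
  -- everywhere, like the given one.
  have h1 : ∀ᵐ x ∂tetVol T, x ∈ interior (tet T) → g x = 0 := by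
    refine isOpen_interior.ae_eq_zero_of_integral_contDiff_smul_eq_zero
      (hgi.locallyIntegrable.locallyIntegrableOn _) fun ψ hψ hc hs => ?_
    have h2 := hgw ψ hψ hc hs
    rw [h0 ψ hψ hc hs] at h2
    simp only [Pi.zero_apply, zero_mul, integral_zero, neg_zero] at h2
    rw [← neg_eq_zero.1 h2.symm]
    simp only [smul_eq_mul, mul_comm]
  have h2 : ∫ x, g x * φ x ∂(tetVol T) = 0 := by
    refine integral_eq_zero_of_ae ?_
    filter_upwards [h1, ae_tetVol_coord_pos T] with x hx hxp
    rw [hx ((mem_interior_tet_iff T).2 hxp), zero_mul, Pi.zero_apply]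
  have h3 := hgt φ hφ
  rwa [h2, add_zero] at h3

theorem infinite_Ioo_third : (Ioo (0 : ℝ) (1 / 3)).Infinite := Ioo_infinite (by norm_num)

/-- The bound 1/3 keeps the remaining barycentric coordinate positive, both inside the tetrahedron
and on a face. -/
theorem eq_zero_of_eval_Ioo {p : Poly3} (h : ∀ y : Fin 3 → ℝ, (∀ i, 0 < y i) →
    (∀ i, y i < 1 / 3) → eval y p = 0) : p = 0 := by
  refine MvPolynomial.funext_set (fun _ => Ioo (0 : ℝ) (1 / 3)) (fun _ => infinite_Ioo_third)
    fun y hy => ?_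
  rw [map_zero]
  exact h y (fun i => (hy i trivial).1) fun i => (hy i trivial).2

theorem coord_three_eq (x : E3) : T.coord 3 x = 1 - lam T x 0 - lam T x 1 - lam T x 2 := by
  have := T.sum_coord_apply_eq_one x
  rw [Fin.sum_univ_four] at this
  change _ = 1 - T.coord 0 x - T.coord 1 x - T.coord 2 x
  linarith

theorem eq_zero_of_eval_lam_interior {p : Poly3}
    (h : ∀ x ∈ interior (tet T), eval (lam T x) p = 0) : p = 0 := by
  refine eq_zero_of_eval_Ioo fun y hy hy' => ?_
  obtain ⟨x, rfl⟩ := exists_lam_eq T y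
  refine h x ((mem_interior_tet_iff T).2 (Fin.lastCases ?_ hy))
  change 0 < T.coord 3 x
  rw [coord_three_eq]
  linarith [hy' 0, hy' 1, hy' 2]

theorem continuous_gradPoly (p : Poly3) : Continuous (gradPoly T p) :=
  continuous_finsetSum _ fun _ _ => (continuous_eval_lam T _).smul continuous_const

/-- For the divergence polynomial d, the test function d ∏ λᵢ vanishes on the boundary. Green's
formula turns the hypothesis into ∫ d² ∏ λᵢ = 0 with positive weight inside, whence d = 0. -/
theorem divPoly_eq_zero {a : Fin 3 → Poly3} (h : ∀ φ : E3 → ℝ, ContDiff ℝ ∞ φ →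
    ∫ x, ⟪contraField T a x, gradient φ x⟫ ∂(tetVol T) = 0) : divPoly a = 0 := by
  set d := divPoly a with hd
  set p : Poly3 := d * ∏ i, bary i with hp
  have hv := contDiff_contraField T a (n := 1)
  have hφ := contDiff_eval_lam T p (n := 1)
  have h1 := integral_tet_diverg_eq_zero T
    (u := fun x => eval (lam T x) p • contraField T a x) (hφ.smul hv) (b := fun i x =>
      eval (lam T x) (d * ∏ j ∈ Finset.univ.erase i, bary j) * ⟪grad T i, contraField T a x⟫)
    (fun i => (continuous_eval_lam T _).mul (continuous_const.inner (continuous_contraField T a)))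
    fun i x => by
      rw [real_inner_smul_right, hp, ← Finset.mul_prod_erase _ _ (Finset.mem_univ i)]
      simp only [map_mul, eval_lam_bary]
      ring
  have h2 (x : E3) : diverg (fun y => eval (lam T y) p • contraField T a y) x =
      eval (lam T x) p * (jac T * eval (lam T x) d) +
        ⟪contraField T a x, gradient (fun y => eval (lam T y) p) x⟫ := by
    rw [diverg_smul (hasFDerivAt_eval_lam T p x) (hv.differentiable one_ne_zero x),
      diverg_contraField, gradient_eval_lam, innerSL_apply_apply, real_inner_comm]
  have hi1 : Integrable (fun x => eval (lam T x) p * (jac T * eval (lam T x) d)) (tetVol T) :=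
    integrable_tetVol T ((continuous_eval_lam T p).mul
      (continuous_const.mul (continuous_eval_lam T d)))
  have hi2 : Integrable (fun x => ⟪contraField T a x, gradient (fun y => eval (lam T y) p) x⟫)
      (tetVol T) := by
    simp only [gradient_eval_lam]
    exact integrable_tetVol T ((continuous_contraField T a).inner (continuous_gradPoly T p))
  have h3 : ∫ x, eval (lam T x) p * (jac T * eval (lam T x) d) ∂(tetVol T) = 0 := by
    have h4 : ∫ x, eval (lam T x) p * (jac T * eval (lam T x) d) +
        ⟪contraField T a x, gradient (fun y => eval (lam T y) p) x⟫ ∂(tetVol T) = 0 := by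
      rw [← h1]
      exact integral_congr_ae (Eventually.of_forall fun x => (h2 x).symm)
    rwa [integral_add hi1 hi2, h _ (contDiff_eval_lam T p), add_zero] at h4
  have h5 (x : E3) : eval (lam T x) p * (jac T * eval (lam T x) d) =
      jac T * (eval (lam T x) d ^ 2 * ∏ i, T.coord i x) := by
    rw [hp, map_mul, map_prod]
    simp only [eval_lam_bary]
    ring
  simp only [h5] at h3
  rw [integral_const_mul, mul_eq_zero, or_iff_right (jac_ne_zero T)] at h3
  have hi3 : Integrable (fun x => eval (lam T x) d ^ 2 * ∏ i, T.coord i x) (tetVol T) :=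
    integrable_tetVol T (((continuous_eval_lam T d).pow 2).mul
      (continuous_finsetProd _ fun i _ => continuous_coord T i))
  rw [integral_eq_zero_iff_of_nonneg_ae (by
    filter_upwards [ae_tetVol_coord_pos T] with x hx
    exact mul_nonneg (sq_nonneg _) (Finset.prod_nonneg fun i _ => (hx i).le)) hi3] at h3
  have h6 : (fun x => eval (lam T x) d) =ᵐ[tetVol T] fun _ => (0 : ℝ) := by
    filter_upwards [ae_tetVol_coord_pos T, h3] with x hx hx3
    rw [Pi.zero_apply, mul_eq_zero,
      or_iff_left (Finset.prod_pos fun i _ => hx i).ne'] at hx3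
    exact pow_eq_zero_iff two_ne_zero |>.1 hx3
  have h7 : EqOn (fun x => eval (lam T x) d) (fun _ => (0 : ℝ)) (interior (tet T)) :=
    Measure.eqOn_open_of_ae_eq (ae_mono (Measure.restrict_mono interior_subset le_rfl) h6)
      isOpen_interior (continuous_eval_lam T d).continuousOn continuousOn_const
  exact eq_zero_of_eval_lam_interior T fun x hx => h7 hx

/-- Integrals against `exp (-k λᵢ)` decay no faster than `1 / k` near a face point where the
integrand does not vanish. -/
theorem exists_le_mul_integral_exp (i : Fin 4) {p : E3} (hp : T.coord i p = 0)
    (hpj : ∀ j, j ≠ i → 0 < T.coord j p) {f : E3 → ℝ} (hf : Continuous f) (hfp : f p ≠ 0) :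
    ∃ c > 0, ∀ k : ℕ, 0 < k →
      c ≤ k * ∫ x, f x ^ 2 * Real.exp (-(k * T.coord i x)) ∂(tetVol T) := by
  -- The direction from `p` to the vertex opposite the face, along which λᵢ grows at unit rate.
  obtain ⟨q, hq⟩ := exists_coord_eq T (w := Pi.single i 1) (by simp)
  set t : E3 := q - p with ht
  have hgt : ⟪grad T i, t⟫ = 1 := by
    have h := coord_add T i p t
    rw [ht, add_sub_cancel, hq, hp, Pi.single_eq_same, zero_add] at h
    exact h.symm
  have hct (x : E3) (s : ℝ) : T.coord i (x + s • t) = T.coord i x + s := by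
    rw [coord_add, real_inner_smul_right, hgt, mul_one]
  have hc := continuous_coord T i
  set ε : ℝ := f p ^ 2 / 2 with hε
  have hfp2 : 0 < f p ^ 2 := by positivity
  have hε0 : 0 < ε := by positivity
  have hU : {x | ε < f x ^ 2} ∩ ⋂ j : {j // j ≠ i}, {x | 0 < T.coord j x} ∈ 𝓝 p := by
    refine inter_mem ?_ (iInter_mem.2 fun j => ?_)
    · exact (isOpen_lt continuous_const (hf.pow 2)).mem_nhds (show ε < f p ^ 2 by linarith)
    · exact (isOpen_lt continuous_const (continuous_coord T j)).mem_nhds (hpj j j.2)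
  obtain ⟨R, hR, hRU⟩ := Metric.mem_nhds_iff.1 hU
  -- A shift along `t` by less than δ moves a point by at most R/2; the added one avoids a zero
  -- denominator.
  set δ : ℝ := R / (2 * (‖t‖ + 1)) with hδ
  have hδ0 : 0 < δ := by positivity
  have hδt : δ * ‖t‖ ≤ R / 2 := by
    have h : δ * (‖t‖ + 1) = R / 2 := by rw [hδ]; field_simp
    linarith
  -- The oblique slab of height `h` over a disc around `p` in the plane λᵢ = 0, projected along `t`.
  set A : ℝ → Set E3 := fun h =>
    {x | 0 ≤ T.coord i x ∧ T.coord i x < h ∧ dist (x - T.coord i x • t) p < R / 2} with hA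
  have hproj : Continuous fun x => x - T.coord i x • t := by fun_prop
  have hAball : A δ ⊆ Metric.ball p R := by
    rintro x ⟨h0, h1, h2⟩
    rw [Metric.mem_ball]
    have h3 : dist x (x - T.coord i x • t) ≤ R / 2 := by
      rw [dist_eq_norm, sub_sub_cancel, norm_smul, Real.norm_of_nonneg h0]
      exact (mul_le_mul_of_nonneg_right h1.le (norm_nonneg t)).trans hδt
    linarith [dist_triangle x (x - T.coord i x • t) p]
  have hAmono {h h' : ℝ} (hh : h ≤ h') : A h ⊆ A h' := fun x hx => ⟨hx.1, hx.2.1.trans_le hh, hx.2.2⟩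
  have hAfin : volume (A δ) ≠ ⊤ := ((measure_mono hAball).trans_lt measure_ball_lt_top).ne
  have hAmeas (h : ℝ) : MeasurableSet (A h) :=
    (measurableSet_le measurable_const hc.measurable).inter
      ((measurableSet_lt hc.measurable measurable_const).inter
        (isOpen_lt (hproj.dist continuous_const) continuous_const).measurableSet)
  have hApos : 0 < volume (A δ) := by
    have ho : IsOpen {x | 0 < T.coord i x ∧ T.coord i x < δ ∧
        dist (x - T.coord i x • t) p < R / 2} :=
      (isOpen_lt continuous_const hc).inter ((isOpen_lt hc continuous_const).inter
        (isOpen_lt (hproj.dist continuous_const) continuous_const))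
    refine (ho.measure_pos volume ⟨p + (δ / 2) • t, ?_⟩).trans_le
      (measure_mono fun x hx => ⟨hx.1.le, hx.2⟩)
    have h1 : T.coord i (p + (δ / 2) • t) = δ / 2 := by rw [hct, hp, zero_add]
    refine ⟨by rw [h1]; positivity, by rw [h1]; linarith, ?_⟩
    rw [h1, add_sub_cancel_right, dist_self]
    positivity
  -- A slab of height `m * h` is covered by `m` translates along `t` of the one of height `h`. So
  -- the slab of height δ/k, on which the exponential is at least exp(-δ), has at least 1/k of the
  -- volume.
  have hAmul (h : ℝ) (hh : 0 ≤ h) (m : ℕ) : volume (A (m * h)) ≤ m * volume (A h) := by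
    induction m with
    | zero =>
      have : A ((0 : ℕ) * h) = ∅ := by
        rw [eq_empty_iff_forall_notMem]
        rintro x ⟨h0, h1, -⟩
        simp at h1
        linarith
      rw [this]
      simp
    | succ m ih =>
      have hsub : A ((m + 1 : ℕ) * h) ⊆
          A (m * h) ∪ (fun x => x + (-(m * h)) • t) ⁻¹' A h := by
        rintro x ⟨h0, h1, h2⟩
        by_cases hx : T.coord i x < m * h
        · exact Or.inl ⟨h0, hx, h2⟩
        · right
          rw [mem_preimage, hA, mem_ofPred_eq, hct]
          push_cast at h1
          refine ⟨by linarith, by linarith, ?_⟩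
          convert h2 using 2
          module
      refine (measure_mono hsub).trans ((measure_union_le _ _).trans ?_)
      rw [measure_preimage_add_right]
      push_cast
      rw [add_mul, one_mul]
      gcongr
  refine ⟨ε * Real.exp (-δ) * volume.real (A δ),
    mul_pos (by positivity) (ENNReal.toReal_pos hApos.ne' hAfin), fun k hk => ?_⟩
  have hk0 : (0 : ℝ) < k := Nat.cast_pos.2 hk
  have hk1 : δ / k ≤ δ := div_le_self hδ0.le (Nat.one_le_cast.2 hk)
  have hAk : A (δ / k) ⊆ A δ := hAmono hk1
  have hAtet : A (δ / k) ⊆ tet T := fun x hx => by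
    rw [mem_tet_iff]
    intro j
    by_cases hj : j = i
    · exact hj ▸ hx.1
    · exact le_of_lt (mem_iInter.1 (hRU (hAball (hAk hx))).2 ⟨j, hj⟩)
  have hfin : volume (A (δ / k)) ≠ ⊤ := ne_top_of_le_ne_top hAfin (measure_mono hAk)
  have h1 : volume.real (A δ) ≤ k * volume.real (A (δ / k)) := by
    have h2 := hAmul (δ / k) (by positivity) k
    rw [mul_div_cancel₀ δ hk0.ne'] at h2
    have h3 := ENNReal.toReal_mono (ENNReal.mul_ne_top (ENNReal.natCast_ne_top k) hfin) h2
    rwa [ENNReal.toReal_mul, ENNReal.toReal_natCast] at h3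
  have hint : Integrable (fun x => f x ^ 2 * Real.exp (-(k * T.coord i x))) (tetVol T) :=
    integrable_tetVol T (by fun_prop)
  have h4 : ε * Real.exp (-δ) * volume.real (A (δ / k)) ≤
      ∫ x in A (δ / k), f x ^ 2 * Real.exp (-(k * T.coord i x)) := by
    refine setIntegral_ge_of_const_le_real (hAmeas _) hfin (fun x hx => ?_)
      (IntegrableOn.mono_set hint hAtet)
    have h5 : ε < f x ^ 2 := (hRU (hAball (hAk hx))).1
    refine mul_le_mul h5.le (Real.exp_le_exp.2 ?_) (Real.exp_pos _).le (sq_nonneg _)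
    have h6 := mul_le_mul_of_nonneg_left hx.2.1.le hk0.le
    rw [mul_div_cancel₀ δ hk0.ne'] at h6
    linarith
  have h7 : ∫ x in A (δ / k), f x ^ 2 * Real.exp (-(k * T.coord i x)) ≤
      ∫ x, f x ^ 2 * Real.exp (-(k * T.coord i x)) ∂(tetVol T) :=
    setIntegral_mono_set hint (Eventually.of_forall fun x => by
      exact mul_nonneg (sq_nonneg _) (Real.exp_pos _).le) (Eventually.of_forall hAtet)
  calc ε * Real.exp (-δ) * volume.real (A δ)
      ≤ ε * Real.exp (-δ) * (k * volume.real (A (δ / k))) := by gcongr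
    _ = k * (ε * Real.exp (-δ) * volume.real (A (δ / k))) := by ring
    _ ≤ _ := by gcongr; exact h4.trans h7

/-- The normal component on a face vanishes if all the weighted boundary terms do. -/
theorem eval_eq_zero_of_coord_eq_zero {a : Fin 3 → Poly3} (h : ∀ φ : E3 → ℝ, ContDiff ℝ ∞ φ →
    ∫ x, ⟪contraField T a x, gradient φ x⟫ ∂(tetVol T) = 0) (i : Fin 4) {F : Poly3}
    (hF : ∀ x, eval (lam T x) F = ⟪contraField T a x, grad T i⟫) {p : E3}
    (hp : T.coord i p = 0) (hpj : ∀ j, j ≠ i → 0 < T.coord j p) : eval (lam T p) F = 0 := by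
  by_contra hne
  obtain ⟨c, hc, hck⟩ := exists_le_mul_integral_exp T i hp hpj (continuous_eval_lam T F) hne
  set g : E3 → ℝ := fun x => ⟪contraField T a x, gradPoly T F x⟫ with hg
  have hgc : Continuous g := (continuous_contraField T a).inner (continuous_gradPoly T F)
  have hcc := continuous_coord T i
  have hFc := continuous_eval_lam T F
  -- Test with F exp(-kλᵢ). As F is the normal component v · ∇λᵢ itself, the pairing of v with the
  -- gradient is exp(-kλᵢ) (v · ∇F - kF²).
  have hk (k : ℕ) : k * ∫ x, eval (lam T x) F ^ 2 * Real.exp (-(k * T.coord i x)) ∂(tetVol T) =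
      ∫ x, Real.exp (-(k * T.coord i x)) * g x ∂(tetVol T) := by
    have hφ : ContDiff ℝ ∞ fun x => eval (lam T x) F * Real.exp (-(k * T.coord i x)) :=
      (contDiff_eval_lam T F).mul (contDiff_const.mul (contDiff_coord T i)).neg.exp
    have hd (x : E3) : ⟪contraField T a x,
        gradient (fun x => eval (lam T x) F * Real.exp (-(k * T.coord i x))) x⟫ =
        Real.exp (-(k * T.coord i x)) * g x -
          k * (eval (lam T x) F ^ 2 * Real.exp (-(k * T.coord i x))) := by
      have h1 := (hasFDerivAt_eval_lam T F x).fun_mul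
        ((hasFDerivAt_coord T i x).const_mul (k : ℝ)).fun_neg.exp
      rw [gradient, h1.fderiv, real_inner_comm, InnerProductSpace.toDual_symm_apply]
      simp only [add_apply, smul_apply, neg_apply, innerSL_apply_apply, smul_eq_mul, hg]
      rw [real_inner_comm (contraField T a x) (grad T i), ← hF,
        real_inner_comm (contraField T a x) (gradPoly T F x)]
      ring
    have h2 := h _ hφ
    simp only [hd] at h2
    rw [integral_sub (integrable_tetVol T (by fun_prop)) (integrable_tetVol T (by fun_prop)),
      integral_const_mul, sub_eq_zero] at h2
    exact h2.symm
  -- The right side tends to zero since λᵢ > 0 almost everywhere, whereas the left side stays above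
  -- `c > 0`.
  have hlim : Tendsto (fun k : ℕ => ∫ x, Real.exp (-(k * T.coord i x)) * g x ∂(tetVol T)) atTop
      (𝓝 (∫ _, (0 : ℝ) ∂(tetVol T))) := by
    refine tendsto_integral_of_dominated_convergence (fun x => |g x|)
      (fun k => Continuous.aestronglyMeasurable (by fun_prop)) (integrable_tetVol T hgc.abs) ?_ ?_
    · intro k
      filter_upwards [ae_tetVol_coord_pos T] with x hx
      rw [norm_mul, Real.norm_of_nonneg (Real.exp_pos _).le, Real.norm_eq_abs]
      refine mul_le_of_le_one_left (abs_nonneg _) (Real.exp_le_one_iff.2 ?_)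
      have := hx i
      rw [neg_nonpos]
      positivity
    · filter_upwards [ae_tetVol_coord_pos T] with x hx
      have h3 : Tendsto (fun k : ℕ => Real.exp (-(k * T.coord i x))) atTop (𝓝 0) :=
        Real.tendsto_exp_neg_atTop_nhds_zero.comp
          (tendsto_natCast_atTop_atTop.atTop_mul_const (hx i))
      simpa using h3.mul_const (g x)
  rw [integral_zero] at hlim
  have h4 : c ≤ 0 := by
    refine ge_of_tendsto hlim ?_
    filter_upwards [eventually_gt_atTop 0] with k hk0
    rw [← hk]
    exact hck k hk0
  linarith

theorem X_dvd_of_eval_face {i : Fin 3} {F : Poly3} (h : ∀ p, T.coord i.castSucc p = 0 →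
    (∀ j, j ≠ i.castSucc → 0 < T.coord j p) → eval (lam T p) F = 0) : X i ∣ F := by
  refine X_dvd_of_restrictCoord (eq_zero_of_eval_Ioo fun y hy hy' => ?_)
  obtain ⟨x, hx⟩ := exists_lam_eq T fun j => if j = i then 0 else y j
  have hxj (j : Fin 3) : T.coord j.castSucc x = if j = i then 0 else y j := congrFun hx j
  have hle (j : Fin 3) : lam T x j < 1 / 3 := by
    rw [hx]
    dsimp only
    split_ifs
    · norm_num
    · exact hy' j
  have he : eval y (restrictCoord i F) = eval (lam T x) F := by
    rw [restrictCoord, eval_bind₁_eq, hx]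
    congr 2
    funext j
    split_ifs <;> simp
  rw [he]
  refine h x (by rw [hxj, if_pos rfl]) fun j => Fin.lastCases (fun _ => ?_) (fun j hj => ?_) j
  · change 0 < T.coord 3 x
    rw [coord_three_eq]
    linarith [hle 0, hle 1, hle 2]
  · rw [hxj, if_neg fun h => hj (congrArg _ h)]
    exact hy j

theorem bary_three_dvd_of_eval_face {F : Poly3} (h : ∀ p, T.coord 3 p = 0 →
    (∀ j, j ≠ 3 → 0 < T.coord j p) → eval (lam T p) F = 0) : bary 3 ∣ F := by
  refine bary_three_dvd_of_restrictLast (eq_zero_of_eval_Ioo fun y hy hy' => ?_)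
  obtain ⟨x, hx⟩ := exists_lam_eq T ![y 0, y 1, 1 - y 0 - y 1]
  have h0 : T.coord 0 x = y 0 := congrFun hx 0
  have h1 : T.coord 1 x = y 1 := congrFun hx 1
  have h2 : T.coord 2 x = 1 - y 0 - y 1 := congrFun hx 2
  have he : eval y (restrictLast F) = eval (lam T x) F := by
    rw [restrictLast, eval_bind₁_eq, hx]
    congr 2
    funext j
    fin_cases j <;> simp
  rw [he]
  refine h x ?_ fun j hj => ?_
  · rw [coord_three_eq, hx]
    simp
  · fin_cases j
    · exact h0 ▸ hy 0
    · exact h1 ▸ hy 1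
    · change 0 < T.coord 2 x
      rw [h2]
      linarith [hy' 0, hy' 1]
    · exact absurd rfl hj

theorem mem_admissible_of_contraField_mem_H0divFree {n : ℕ} {a : Fin 3 → Poly3}
    (ha : ∀ i, (a i).totalDegree ≤ n) (h : contraField T a ∈ H0divFree T) : a ∈ admissible n := by
  have h0 := fun φ hφ => integral_inner_gradient_eq_zero_of_mem_H0divFree T h (φ := φ) hφ
  refine ⟨ha, divPoly_eq_zero T h0, fun i => X_dvd_of_eval_face T fun p hp hpj => ?_,
    bary_three_dvd_of_eval_face T fun p hp hpj => ?_⟩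
  · have h1 := eval_eq_zero_of_coord_eq_zero T h0 i.castSucc (F := C (jac T) * a i)
      (fun x => by rw [inner_contraField, map_mul, eval_C]) hp hpj
    rw [map_mul, eval_C, mul_eq_zero, or_iff_right (jac_ne_zero T)] at h1
    exact h1
  · have h1 := eval_eq_zero_of_coord_eq_zero T h0 3 (F := C (-jac T) * (a 0 + a 1 + a 2))
      (fun x => by rw [inner_contraField_three, map_mul, eval_C]; ring) hp hpj
    rw [map_mul, eval_C, mul_eq_zero, or_iff_right (neg_ne_zero.2 (jac_ne_zero T))] at h1
    exact h1

theorem span_curl_selectedBubble (n : ℕ) :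
    (Submodule.span ℝ (range fun p => curl (selectedBubble T n p)) : Set (E3 → E3)) =
      H0divFree T ∩ polyVec n := by
  have h : (range fun p => curl (selectedBubble T n p)) =
      contraFieldLin T '' range fun p : selected n => curlPoly (bubblePoly (n + 1) p.1.1 p.1.2) := by
    rw [← range_comp]
    exact congrArg range (funext fun p => curl_selectedBubble T n p)
  rw [h, Submodule.span_image, span_curlPoly_bubblePoly, Submodule.map_coe]
  ext v
  constructor
  · rintro ⟨a, ⟨ha, hdiv, hX, hw⟩, rfl⟩
    exact ⟨contraField_mem_H0divFree T hdiv hX hw, contraField_mem_polyVec T ha⟩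
  · rintro ⟨hv, hp⟩
    obtain ⟨a, ha, rfl⟩ := exists_eq_contraField T hp
    exact ⟨a, mem_admissible_of_contraField_mem_H0divFree T ha hv, rfl⟩

end BernsteinCurl

theorem lemma3p2 (n : ℕ) (T : AffineBasis (Fin 4) ℝ E3) :
    (∀ (ℓ : Fin 4), ∀ α ∈ BernsteinCurl.interiorIndex (n + 2),
      BernsteinCurl.cellBubble T (n + 1) ℓ α ∈
        BernsteinCurl.H0curl T ∩ BernsteinCurl.nedelec n) ∧
    (Set.range (BernsteinCurl.selectedBubble T n)).encard =
      ((2 * (n + 1).choose 3 + n.choose 2 : ℕ) : ℕ∞) ∧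
    LinearIndependent ℝ (BernsteinCurl.selectedBubble T n) ∧
    LinearIndependent ℝ (fun p => BernsteinCurl.curl (BernsteinCurl.selectedBubble T n p)) ∧
    (Submodule.span ℝ
        (Set.range fun p => BernsteinCurl.curl (BernsteinCurl.selectedBubble T n p)) :
      Set (E3 → E3)) = BernsteinCurl.H0divFree T ∩ BernsteinCurl.polyVec n :=
  ⟨fun ℓ _ hα => ⟨BernsteinCurl.cellBubble_mem_H0curl T ℓ hα,
      BernsteinCurl.cellBubble_mem_nedelec T ℓ hα⟩,
    BernsteinCurl.encard_range_selectedBubble T n,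
    BernsteinCurl.linearIndependent_selectedBubble T n,
    BernsteinCurl.linearIndependent_curl_selectedBubble T n,
    BernsteinCurl.span_curl_selectedBubble T n⟩
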